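/- All groups are finite, all $G$-modules are finite-dimensional over $\mathbb{C}$. A covariant of a finite group $G$ is a $G$-equivariant morphism (polynomial map) $\phi\colon V\to W$ between $G$-modules; its dimension is $\dim\phi:=\dim\overline{\phi(V)}$ (Zariski closure), and it is faithful if $G$ acts faithfully on $\phi(V)$. The covariant dimension $\operatorname{covdim} G$ is the minimum of $\dim\phi$ over all faithful covariants $\phi$ of $G$. A subgroup $P\subseteq G$ is said to act on a module $M$ as scalar multiplication by $\mathbb{Z}/p$ if its image in $\operatorname{GL}(M)$ is $\{\zeta\cdot\mathrm{Id} : \zeta\in\mathbb{C},\ \zeta^p=1\}$. A group is called faithful if it admits a faithful irreducible representation. **(a)** Let $V=W\oplus\mathbb{C}_\chi$ be a faithful representation of $G$, where $W$ is irreducible and $\chi\colon G\to\mathbb{C}^*$ is a character of $G$. Let $H$ denote the kernel of $G\to\operatorname{GL}(W)$, and let $p$ be a prime which divides $|H|$. Then the following two conditions are equivalent: (i) there is a subgroup of $\ker\chi$ acting as scalar multiplication by $\mathbb{Z}/p$ on $W$; (ii) there is a subgroup of $G$ acting as scalar multiplication by $\mathbb{Z}/p$ on $V$. If they hold, then $$\operatorname{covdim}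 G=\operatorname{covdim}(G/H)+1.$$ **(b)** Let $p$ be a prime, let $\ell>m\ge 0$, let $\mu_N\subset\mathbb{C}^*$ denote the group of $N$-th roots of unity and let $\pi\colon\mu_{p^\ell}\to\mu_{p^m}$ be the homomorphism $\xi\mapsto\xi^{p^{\ell-m}}$. Consider a commutative diagram of finite groups with exact rows $$\begin{array}{ccccccccc} 1&\to& K&\to& G&\xrightarrow{\ \chi\ }&\mu_{p^\ell}&\to&1\\ &&\|&&\downarrow&&\ \downarrow{\scriptstyle\pi}&&\\ 1&\to& K&\to& G'&\xrightarrow{\ \chi'\ }&\mu_{p^m}&\to&1 \end{array}$$ If $G'$ is faithful and $p$ divides $|Z(G')\cap K|$, where $Z(G')$ is the center of $G'$, then $$\operatorname{covdim} G\ge\operatorname{covdim} G'+1.$$ -/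

import Mathlib

namespace CovariantDimension

/-- A covariant of `G`: a polynomial map `φ : ℂⁿ → ℂᵐ`, given by its `m` coordinate polynomials in
`n` variables, which is equivariant for linear representations of `G` on `ℂⁿ` and on `ℂᵐ`.
Every finite-dimensional complex `G`-module is isomorphic to one with underlying space `ℂⁿ`, and
polynomial maps, equivariance, faithfulness and dimension of the image are unchanged by linear
changes of coordinates, so these are all covariants up to isomorphism of the two modules. -/
structure Covariant (G : Type*) [Group G] (n m : ℕ) where
  /-- the `G`-module structure on the source -/
  source : Representation ℂ G (Fin n → ℂ)
  /-- the `G`-module structure on the target -/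
  target : Representation ℂ G (Fin m → ℂ)
  /-- the coordinate polynomials of the morphism -/
  poly : Fin m → MvPolynomial (Fin n) ℂ
  /-- `φ (g • v) = g • φ v` -/
  equivariant : ∀ (g : G) (v : Fin n → ℂ),
    (fun j => MvPolynomial.eval (source g v) (poly j)) =
      target g (fun j => MvPolynomial.eval v (poly j))

namespace Covariant

variable {G : Type*} [Group G] {n m : ℕ}

/-- The underlying map `ℂⁿ → ℂᵐ` of a covariant. -/
noncomputable def toFun (φ : Covariant G n m) (v : Fin n → ℂ) : Fin m → ℂ :=
  fun j => MvPolynomial.eval v (φ.poly j)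

/-- `φ` is faithful if `G` acts faithfully on the image of `φ`: only the identity fixes every
point of the image. -/
def IsFaithful (φ : Covariant G n m) : Prop :=
  ∀ g : G, (∀ v : Fin n → ℂ, φ.target g (φ.toFun v) = φ.toFun v) → g = 1

/-- The dimension of `φ`: the dimension of the Zariski closure of its image, that is, the Krull
dimension of the coordinate ring `ℂ[y₁, …, yₘ] / I(φ(ℂⁿ))` of this closure. -/
noncomputable def dim (φ : Covariant G n m) : WithBot ℕ∞ :=
  ringKrullDim
    (MvPolynomial (Fin m) ℂ ⧸ MvPolynomial.vanishingIdeal ℂ (Set.range φ.toFun))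

end Covariant

/-- The set of dimensions of faithful covariants of `G`. -/
def faithfulDims (G : Type*) [Group G] : Set ℕ :=
  {d | ∃ (n m : ℕ) (φ : Covariant G n m), φ.IsFaithful ∧ φ.dim = (d : WithBot ℕ∞)}

/-- The covariant dimension of `G`: the minimum of `dim φ` over all faithful covariants `φ`
of `G`. For finite `G` it is attained, see `covdim_mem`. -/
noncomputable def covdim (G : Type*) [Group G] : ℕ :=
  sInf (faithfulDims G)

/-- The regular representation in coordinates, with its identity map, as a covariant. -/
noncomputable def regularCovariant (G : Type*) [Group G] {n : ℕ} (e : G ≃ Fin n) :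
    Covariant G n n where
  source :=
    { toFun := fun g => LinearMap.funLeft ℂ ℂ (fun i => e (g⁻¹ * e.symm i))
      map_one' := by ext; simp [LinearMap.funLeft_apply]
      map_mul' := fun g h => by
        ext; simp [LinearMap.funLeft_apply, mul_assoc] }
  target :=
    { toFun := fun g => LinearMap.funLeft ℂ ℂ (fun i => e (g⁻¹ * e.symm i))
      map_one' := by ext; simp [LinearMap.funLeft_apply]
      map_mul' := fun g h => by
        ext; simp [LinearMap.funLeft_apply, mul_assoc] }
  poly := fun i => MvPolynomial.X i
  equivariant := fun g v => by
    funext j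
    simp [LinearMap.funLeft_apply]

theorem faithfulDims_nonempty (G : Type*) [Group G] [Finite G] : (faithfulDims G).Nonempty := by
  obtain ⟨n, ⟨e⟩⟩ := Finite.exists_equiv_fin G
  have hfun : (regularCovariant G e).toFun = id := by
    funext v j
    simp [Covariant.toFun, regularCovariant]
  refine ⟨n, n, n, regularCovariant G e, ?_, ?_⟩
  · intro g hg
    have h1 := congrFun (hg (Pi.single (e 1) 1)) (e g)
    rw [hfun] at h1
    by_contra hne
    have hne' : e g ≠ e 1 := fun h => hne (e.injective h)
    simp [regularCovariant, LinearMap.funLeft_apply, hne'] at h1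
  · have hbot : MvPolynomial.vanishingIdeal ℂ (Set.range (regularCovariant G e).toFun) = ⊥ := by
      rw [hfun, eq_bot_iff]
      intro p hp
      have hp' : ∀ x ∈ Set.range (id : (Fin n → ℂ) → (Fin n → ℂ)),
        MvPolynomial.aeval x p = 0 := hp
      refine (Submodule.mem_bot _).2 (MvPolynomial.funext fun x => ?_)
      simpa using hp' x ⟨x, rfl⟩
    rw [Covariant.dim, hbot,
      ringKrullDim_eq_of_ringEquiv (RingEquiv.quotientBot (MvPolynomial (Fin n) ℂ)),
      MvPolynomial.ringKrullDim_of_isNoetherianRing]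
    simp

theorem covdim_mem (G : Type*) [Group G] [Finite G] : covdim G ∈ faithfulDims G :=
  Nat.sInf_mem (faithfulDims_nonempty G)

/-- The one-dimensional representation `ℂ_χ` on which `g` acts as multiplication by `χ g`. -/
noncomputable def characterRep {G : Type*} [Group G] (χ : G →* ℂˣ) : Representation ℂ G ℂ where
  toFun := fun g => ((χ g : ℂˣ) : ℂ) • (1 : Module.End ℂ ℂ)
  map_one' := by simp
  map_mul' := fun g h => by
    ext
    simp [mul_comm]

/-- The subgroup `P` acts on the module `ρ` as scalar multiplication by `ℤ/p`: the operators by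
which the elements of `P` act are exactly the multiplications by the complex `p`-th roots of
unity. -/
def ActsAsScalars {G V : Type*} [Group G] [AddCommGroup V] [Module ℂ V]
    (ρ : Representation ℂ G V) (P : Subgroup G) (p : ℕ) : Prop :=
  (fun g => ρ g) '' (P : Set G) =
    {a : Module.End ℂ V | ∃ ζ : ℂ, ζ ^ p = 1 ∧ a = ζ • (1 : Module.End ℂ V)}

/-- `G` is faithful: it admits a faithful irreducible finite-dimensional complex
representation. -/
def IsFaithfulGroup (G : Type*) [Group G] : Prop :=
  ∃ (n : ℕ) (ρ : Representation ℂ G (Fin n → ℂ)), ρ.IsIrreducible ∧ Function.Injective ρ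

end CovariantDimension

/-! The upper bound in (a) adds the coordinate of `ℂ_χ` to a minimal covariant of `G/H`.

For the lower bound, interpolation turns a minimal covariant of `G` into an equivariant self-map of
`V = W ⊕ ℂ_χ` with both components nonzero and dimension at most `covdim G`. Passing to leading
forms for the lexicographic order on bidegrees does not raise the dimension
(`imageDim_le_of_isLeadingForm`), so the components may be taken bihomogeneous, of bidegrees `(a,
b)` and `(c, d)`. Some `z` acts as a primitive `p`-th root of unity on `W` and trivially on `ℂ_χ`;
some `h` does the reverse. Equivariance under both makes the matrix with rows `(a, b)`, `(c, d)` the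
identity modulo `p`, so its determinant is nonzero. A `ℤ`-grading then gives the `W`-component
degree zero and the `χ`-component nonzero degree, hence the latter is transcendental over the former
and accounts for the `+1` (`covdim_add_one_le`). The `W`-component, dehomogenized and multiplied by
a semi-invariant, is a faithful covariant of `G/H` (`covdim_le_imageDim_some`).

For (b), pull a faithful irreducible module of `G'` back to `G` and add the character `χ`. Schur's
lemma on `Z(G') ∩ K` provides `z`, and the kernel of `G → G'` provides `h`. -/

namespace CovariantDimension

open MvPolynomial

/-! ### Dimension of the image as a transcendence degree -/

section

/-- An injective integral extension of rings preserves the Krull dimension. -/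
theorem ringKrullDim_eq_of_injective_integral {A B : Type*} [CommRing A] [CommRing B] [Algebra A B]
    [Algebra.IsIntegral A B] [FaithfulSMul A B] : ringKrullDim A = ringKrullDim B := by
  apply le_antisymm
  · refine iSup_le fun l => ?_
    -- Lying over starts the lifted chain and going up continues it; the other inequality is
    -- incomparability.
    obtain ⟨Q, hQ, hover⟩ := Ideal.nonempty_primesOver (S := B) l.head.asIdeal
    obtain ⟨L, hL, -⟩ := Ideal.exists_ltSeries_of_hasGoingUp l Q
    rw [← hL]
    exact le_iSup (fun L : LTSeries (PrimeSpectrum B) => (L.length : WithBot ℕ∞)) L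
  · refine Order.krullDim_le_of_strictMono (PrimeSpectrum.comap (algebraMap A B)) ?_
    intro I J h
    exact Ideal.IsIntegral.comap_lt_comap (R := A) (I := I.asIdeal) (J := J.asIdeal) h

/-- The Krull dimension of an affine domain is its transcendence degree. -/
theorem ringKrullDim_eq_trdeg {k A : Type*} [Field k] [CommRing A] [IsDomain A] [Algebra k A]
    [Algebra.FiniteType k A] :
    ringKrullDim A = ((Algebra.trdeg k A).toNat : WithBot ℕ∞) := by
  obtain ⟨s, g, hg, hint⟩ := exists_integral_inj_algHom_of_fg k A
  let _ := g.toRingHom.toAlgebra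
  have : IsScalarTower k (MvPolynomial (Fin s) k) A := IsScalarTower.of_algHom g
  have : Algebra.IsIntegral (MvPolynomial (Fin s) k) A := ⟨hint⟩
  have : FaithfulSMul (MvPolynomial (Fin s) k) A :=
    (faithfulSMul_iff_algebraMap_injective _ _).2 hg
  rw [← ringKrullDim_eq_of_injective_integral (A := MvPolynomial (Fin s) k),
    MvPolynomial.ringKrullDim_of_isNoetherianRing]
  have h := lift_trdeg_add_eq k (MvPolynomial (Fin s) k) A
  rw [trdeg_eq_zero (R := MvPolynomial (Fin s) k) (A := A),
    MvPolynomial.trdeg_of_isDomain] at h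
  have h2 := congrArg Cardinal.toNat h
  simp at h2
  simp [h2]

variable {σ τ κ : Type}

/-- The dimension of the closure of the image of the polynomial map with components `f`, as the
transcendence degree of the algebra generated by the components. -/
noncomputable def imageDim (f : τ → MvPolynomial σ ℂ) : ℕ :=
  (Algebra.trdeg ℂ (Algebra.adjoin ℂ (Set.range f))).toNat

instance adjoin_range_finiteType [Finite τ] (f : τ → MvPolynomial σ ℂ) :
    Algebra.FiniteType ℂ (Algebra.adjoin ℂ (Set.range f)) :=
  (Subalgebra.fg_iff_finiteType _).1 ⟨(Set.finite_range f).toFinset, by simp⟩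

theorem eval_aeval_eq (f : τ → MvPolynomial σ ℂ) (v : σ → ℂ) (P : MvPolynomial τ ℂ) :
    eval v (aeval f P) = eval (fun j => eval v (f j)) P := by
  induction P using MvPolynomial.induction_on with
  | C a => simp
  | add p q hp hq => simp only [map_add, hp, hq]
  | mul_X p i hp => simp only [map_mul, aeval_X, eval_X, hp]

theorem vanishingIdeal_range_eq_ker [Finite σ] (f : τ → MvPolynomial σ ℂ) :
    vanishingIdeal ℂ (Set.range fun v j => eval v (f j)) = RingHom.ker (aeval (R := ℂ) f) := by
  ext P
  rw [mem_vanishingIdeal_iff, Set.forall_mem_range, RingHom.mem_ker]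
  have key : ∀ v, aeval (fun j => eval v (f j)) P = eval v (aeval f P) := fun v => by
    rw [eval_aeval_eq]
    rfl
  constructor
  · intro h
    refine MvPolynomial.funext fun v => ?_
    rw [← key, h, map_zero]
  · intro h v
    rw [key, h, map_zero]

/-- A polynomial vanishes on the image iff its pullback is zero, so the coordinate ring of the
closure is the algebra generated by the components, an affine domain. -/
theorem Covariant.dim_eq_imageDim {G : Type*} [Group G] {n m : ℕ} (φ : Covariant G n m) :
    φ.dim = (imageDim φ.poly : WithBot ℕ∞) := by
  rw [imageDim, ← ringKrullDim_eq_trdeg, Covariant.dim]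
  have h1 : vanishingIdeal ℂ (Set.range φ.toFun) = RingHom.ker (aeval (R := ℂ) φ.poly) :=
    vanishingIdeal_range_eq_ker φ.poly
  rw [h1, Algebra.adjoin_range_eq_range_aeval]
  exact ringKrullDim_eq_of_ringEquiv
    (Ideal.quotientKerEquivRange (aeval (R := ℂ) φ.poly)).toRingEquiv

theorem exists_algebraicIndependent_card_eq_imageDim [Finite τ] (f : τ → MvPolynomial σ ℂ) :
    ∃ s : Set τ, AlgebraicIndependent ℂ (fun i : s => f i) ∧ Nat.card s = imageDim f := by
  let g : τ → Algebra.adjoin ℂ (Set.range f) := fun i => ⟨f i, Algebra.subset_adjoin ⟨i, rfl⟩⟩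
  have hg : Algebra.adjoin ℂ (Set.range g) = ⊤ := by
    have : Subalgebra.map (Algebra.adjoin ℂ (Set.range f)).val (Algebra.adjoin ℂ (Set.range g)) =
        Subalgebra.map (Algebra.adjoin ℂ (Set.range f)).val ⊤ := by
      rw [AlgHom.map_adjoin, ← Set.range_comp, Algebra.map_top, Subalgebra.range_val]
      rfl
    exact Subalgebra.map_injective Subtype.val_injective this
  have : Algebra.IsAlgebraic (Algebra.adjoin ℂ (Set.range g))
      (Algebra.adjoin ℂ (Set.range f)) :=
    ⟨fun x => isAlgebraic_algebraMap (⟨x, by rw [hg]; trivial⟩ : Algebra.adjoin ℂ (Set.range g))⟩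
  have : FaithfulSMul ℂ (Algebra.adjoin ℂ (Set.range f)) :=
    (faithfulSMul_iff_algebraMap_injective _ _).2 (RingHom.injective _)
  obtain ⟨t, ht, hb⟩ := exists_isTranscendenceBasis_subset (R := ℂ) (Set.range g)
  -- Components may coincide, so one index is chosen for each element of the transcendence basis.
  choose e he using fun x : t => ht x.2
  have hinj : Function.Injective e := fun x y h => Subtype.ext (by rw [← he, ← he, h])
  refine ⟨Set.range e, ?_, ?_⟩
  · have h1 : AlgebraicIndependent ℂ (fun x : t => f (e x)) := by
      have := hb.1.map' (f := (Algebra.adjoin ℂ (Set.range f)).val) Subtype.val_injective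
      convert this using 1
      funext x
      simp [← he, g]
    have h2 := h1.comp (Equiv.ofInjective e hinj).symm (Equiv.injective _)
    convert h2 using 1
    funext x
    obtain ⟨_, y, rfl⟩ := x
    simp
  · rw [imageDim, ← hb.cardinalMk_eq_trdeg, Nat.card_congr (Equiv.ofInjective e hinj).symm]
    rfl

theorem card_le_imageDim [Finite τ] {f : τ → MvPolynomial σ ℂ} (e : κ → τ)
    (h : AlgebraicIndependent ℂ (fun i => f (e i))) : Nat.card κ ≤ imageDim f := by
  have h' : AlgebraicIndependent ℂ (fun i =>
      (⟨f (e i), Algebra.subset_adjoin ⟨e i, rfl⟩⟩ : Algebra.adjoin ℂ (Set.range f))) :=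
    (AlgHom.algebraicIndependent_iff (Algebra.adjoin ℂ (Set.range f)).val
      Subtype.val_injective).1 h
  have h2 := h'.lift_cardinalMk_le_trdeg
  have h3 := Cardinal.toNat_le_toNat h2 (by simpa using trdeg_lt_aleph0_of_finiteType)
  simpa [Nat.card, imageDim] using h3

/-- Used for composition with a polynomial map on the target side. -/
theorem imageDim_le_of_mem_adjoin [Finite τ] [Finite κ] {f : τ → MvPolynomial σ ℂ}
    {g : κ → MvPolynomial σ ℂ} (h : ∀ k, g k ∈ Algebra.adjoin ℂ (Set.range f)) :
    imageDim g ≤ imageDim f := by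
  have hle : Algebra.adjoin ℂ (Set.range g) ≤ Algebra.adjoin ℂ (Set.range f) :=
    Algebra.adjoin_le (by rintro _ ⟨k, rfl⟩; exact h k)
  exact Cardinal.toNat_le_toNat (trdeg_le_of_injective (Subalgebra.inclusion hle)
    (Subalgebra.inclusion_injective hle)) (trdeg_lt_aleph0_of_finiteType)

/-- The hypothesis is an inclusion of images: a relation among the `f j` then also holds among the
`g j`. -/
theorem imageDim_le_of_forall_exists_eval_eq {σ' : Type} [Finite τ] [Finite σ']
    {f : τ → MvPolynomial σ ℂ} {g : τ → MvPolynomial σ' ℂ}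
    (h : ∀ v' : σ' → ℂ, ∃ v : σ → ℂ, ∀ j, eval v' (g j) = eval v (f j)) :
    imageDim g ≤ imageDim f := by
  obtain ⟨s, hs, hcard⟩ := exists_algebraicIndependent_card_eq_imageDim g
  rw [← hcard]
  refine card_le_imageDim (fun i : s => (i : τ)) ?_
  rw [algebraicIndependent_iff] at hs ⊢
  intro P hP
  refine hs P (MvPolynomial.funext fun v' => ?_)
  obtain ⟨v, hv⟩ := h v'
  have := congrArg (eval v) hP
  rw [eval_aeval_eq] at this ⊢
  simpa [hv] using this

end

/-! ### Equivariant polynomial maps and interpolation -/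

section

variable {G : Type*} [Group G] {σ τ κ : Type}

/-- The coordinate polynomials of a linear map. -/
noncomputable def linearPoly [Fintype σ] [DecidableEq σ] (L : (σ → ℂ) →ₗ[ℂ] (τ → ℂ)) (j : τ) :
    MvPolynomial σ ℂ :=
  ∑ i, C (L (Pi.single i 1) j) * X i

@[simp]
theorem eval_linearPoly [Fintype σ] [DecidableEq σ] (L : (σ → ℂ) →ₗ[ℂ] (τ → ℂ)) (j : τ)
    (v : σ → ℂ) : eval v (linearPoly L j) = L v j := by
  conv_rhs => rw [← LinearMap.sum_single_apply (fun _ : σ => ℂ) v, map_sum]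
  simp only [linearPoly, map_sum, map_mul, eval_C, eval_X, Finset.sum_apply]
  refine Finset.sum_congr rfl fun i _ => ?_
  have : (Pi.single i (v i) : σ → ℂ) = v i • Pi.single i 1 := by
    rw [← Pi.single_smul]; simp
  simp [this, mul_comm]

/-- The polynomial map with components `f` is equivariant. -/
def IsEquivariant (R : Representation ℂ G (σ → ℂ)) (S : Representation ℂ G (τ → ℂ))
    (f : τ → MvPolynomial σ ℂ) : Prop :=
  ∀ (g : G) (v : σ → ℂ), (fun j => eval (R g v) (f j)) = S g (fun j => eval v (f j))

/-- Conjugating a representation by a linear equivalence. -/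
def conjRep {V W : Type*} [AddCommGroup V] [Module ℂ V] [AddCommGroup W] [Module ℂ W]
    (e : V ≃ₗ[ℂ] W) (R : Representation ℂ G V) : Representation ℂ G W where
  toFun g := e.toLinearMap ∘ₗ R g ∘ₗ e.symm.toLinearMap
  map_one' := by ext; simp
  map_mul' g h := by ext; simp

@[simp]
theorem conjRep_apply {V W : Type*} [AddCommGroup V] [Module ℂ V] [AddCommGroup W] [Module ℂ W]
    (e : V ≃ₗ[ℂ] W) (R : Representation ℂ G V) (g : G) (w : W) :
    conjRep e R g w = e (R g (e.symm w)) := rfl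

theorem exists_eval_ne_zero {α : Type*} [Finite α] [Finite σ] (F : α → MvPolynomial σ ℂ)
    (hF : ∀ a, F a ≠ 0) : ∃ v : σ → ℂ, ∀ a, eval v (F a) ≠ 0 := by
  cases nonempty_fintype α
  by_contra! h
  have : ∏ a, F a = 0 := MvPolynomial.funext fun v => by
    obtain ⟨a, ha⟩ := h v
    rw [map_prod, map_zero]
    exact Finset.prod_eq_zero (Finset.mem_univ a) ha
  obtain ⟨a, -, ha⟩ := Finset.prod_eq_zero_iff.1 this
  exact hF a ha

theorem exists_eval_eq_one (v : σ → ℂ) (T : Finset (σ → ℂ)) :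
    ∃ h : MvPolynomial σ ℂ, eval v h = 1 ∧ ∀ u ∈ T, u ≠ v → eval u h = 0 := by
  classical
  induction T using Finset.induction_on with
  | empty => exact ⟨1, by simp⟩
  | insert u T _ ih =>
    obtain ⟨h, h1, h2⟩ := ih
    by_cases huv : u = v
    · refine ⟨h, h1, fun x hx hxv => ?_⟩
      rcases Finset.mem_insert.1 hx with rfl | hx
      · exact absurd huv hxv
      · exact h2 x hx hxv
    · obtain ⟨i, hi⟩ := Function.ne_iff.1 huv
      refine ⟨h * (C (v i - u i)⁻¹ * (X i - C (u i))), ?_, fun x hx hxv => ?_⟩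
      · have : v i - u i ≠ 0 := sub_ne_zero.2 (Ne.symm hi)
        simp [h1, this]
      · rcases Finset.mem_insert.1 hx with rfl | hx
        · simp
        · simp [h2 x hx hxv]

/-- Equivariant interpolation at one point. -/
theorem exists_isEquivariant_eval_eq [Finite G] [Fintype σ] (R : Representation ℂ G (σ → ℂ))
    (S : Representation ℂ G (τ → ℂ)) (v : σ → ℂ) (w : τ → ℂ) (h : ∀ g, R g v = v → S g w = w) :
    ∃ f : τ → MvPolynomial σ ℂ, IsEquivariant R S f ∧ ∀ j, eval v (f j) = w j := by
  classical
  cases nonempty_fintype G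
  obtain ⟨q, hq1, hq2⟩ := exists_eval_eq_one v (Finset.univ.image fun g => R g v)
  -- Averaging the translates of `q` times `S g w` gives an equivariant map. At `v` only the
  -- stabilizer contributes, each term being `w`; hence the division by its order `N`.
  set N : ℂ := ((Finset.univ.filter fun g : G => R g⁻¹ v = v).card : ℂ) with hN
  have hN0 : N ≠ 0 := by
    rw [hN, Nat.cast_ne_zero]
    exact Finset.card_ne_zero_of_mem (a := 1) (by simp)
  let f : τ → MvPolynomial σ ℂ := fun j =>
    C N⁻¹ * ∑ g : G, aeval (linearPoly (R g⁻¹)) q * C (S g w j)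
  have hf : ∀ x, (fun j => eval x (f j)) = N⁻¹ • ∑ g : G, eval (R g⁻¹ x) q • S g w := by
    intro x
    funext j
    simp only [f, map_mul, map_sum, eval_C, eval_aeval_eq, eval_linearPoly, Pi.smul_apply,
      Finset.sum_apply, smul_eq_mul]
  refine ⟨f, fun k x => ?_, fun j => ?_⟩
  · rw [hf, hf, map_smul, map_sum]
    congr 1
    refine Fintype.sum_equiv (Equiv.mulLeft k⁻¹) _ _ fun g => ?_
    simp only [Equiv.coe_mulLeft, map_smul, mul_inv_rev, inv_inv]
    rw [map_mul R, ← Module.End.mul_apply (S k), ← map_mul S, mul_inv_cancel_left]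
    rfl
  · rw [show eval v (f j) = _ from congrFun (hf v) j]
    have h2 : ∑ g : G, eval (R g⁻¹ v) q • S g w = N • w := by
      have hA : ∀ g ∈ Finset.univ.filter (fun g : G => R g⁻¹ v = v),
          eval (R g⁻¹ v) q • S g w = w := fun g hg => by
        have hg' := (Finset.mem_filter.1 hg).2
        have h3 : R g v = v := by
          conv_lhs => rw [← hg', ← Module.End.mul_apply, ← map_mul]
          simp
        rw [hg', hq1, one_smul, h g h3]
      have hB : ∀ g ∈ Finset.univ.filter (fun g : G => ¬ R g⁻¹ v = v),
          eval (R g⁻¹ v) q • S g w = 0 := fun g hg => by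
        rw [hq2 _ (Finset.mem_image_of_mem _ (Finset.mem_univ _)) (Finset.mem_filter.1 hg).2,
          zero_smul]
      rw [hN, ← Finset.sum_filter_add_sum_filter_not Finset.univ (fun g : G => R g⁻¹ v = v),
        Finset.sum_congr rfl hA, Finset.sum_eq_zero hB, add_zero, Finset.sum_const,
        Nat.cast_smul_eq_nsmul]
    rw [h2, smul_smul, inv_mul_cancel₀ hN0, one_smul]

/-- For each `g ≠ 1` the points whose image `g` fixes form a proper closed subset, and finitely many
of these do not cover affine space. -/
theorem exists_trivial_stabilizer [Finite G] [Finite σ] [Fintype τ]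
    (S : Representation ℂ G (τ → ℂ)) (f : τ → MvPolynomial σ ℂ)
    (hf : ∀ g, (∀ v, S g (fun j => eval v (f j)) = fun j => eval v (f j)) → g = 1) :
    ∃ v : σ → ℂ, ∀ g, S g (fun j => eval v (f j)) = (fun j => eval v (f j)) → g = 1 := by
  classical
  have : ∀ g : {g : G // g ≠ 1}, ∃ j, aeval f (linearPoly (S g) j) - f j ≠ 0 := by
    intro g
    by_contra! h
    refine g.2 (hf g fun v => funext fun j => ?_)
    have := congrArg (eval v) (h j)
    rwa [map_sub, map_zero, sub_eq_zero, eval_aeval_eq, eval_linearPoly] at this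
  choose j hj using this
  obtain ⟨v, hv⟩ := exists_eval_ne_zero _ hj
  refine ⟨v, fun g hg => ?_⟩
  by_contra hne
  apply hv ⟨g, hne⟩
  simp only [map_sub, eval_aeval_eq, eval_linearPoly, hg, sub_self]

/-- Allows arbitrary finite index types, such as `Option ι`, in place of `Fin n`. -/
theorem covdim_le_imageDim [Fintype σ] [Fintype τ] (R : Representation ℂ G (σ → ℂ))
    (S : Representation ℂ G (τ → ℂ)) (f : τ → MvPolynomial σ ℂ) (hf : IsEquivariant R S f)
    (hfaith : ∀ g, (∀ v, S g (fun j => eval v (f j)) = fun j => eval v (f j)) → g = 1) :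
    covdim G ≤ imageDim f := by
  let e := Fintype.equivFin σ
  let e' := Fintype.equivFin τ
  let φ : Covariant G (Fintype.card σ) (Fintype.card τ) :=
    { source := conjRep (LinearEquiv.funCongrLeft ℂ ℂ e.symm) R
      target := conjRep (LinearEquiv.funCongrLeft ℂ ℂ e'.symm) S
      poly := fun j => rename e (f (e'.symm j))
      equivariant := fun g v => by
        have := hf g (v ∘ e)
        funext j
        have h2 := congrFun this (e'.symm j)
        simpa [eval_rename, LinearMap.funLeft, Function.comp_def] using h2 }
  have hmem : imageDim φ.poly ∈ faithfulDims G := by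
    refine ⟨_, _, φ, fun g hg => hfaith g fun v => ?_, φ.dim_eq_imageDim⟩
    have := hg (v ∘ e.symm)
    funext j
    have h2 := congrFun this (e' j)
    simpa [φ, Covariant.toFun, eval_rename, LinearMap.funLeft, Function.comp_def] using h2
  refine (Nat.sInf_le hmem).trans ?_
  refine le_trans (b := imageDim fun j => f (e'.symm j)) ?_
    (imageDim_le_of_mem_adjoin fun k => Algebra.subset_adjoin ⟨_, rfl⟩)
  exact imageDim_le_of_forall_exists_eval_eq fun v => ⟨v ∘ e, fun j => by simp [φ, eval_rename]⟩

/-- Every faithful module can serve as the source, and every module as the target, of an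
equivariant map of dimension at most `covdim G` with a prescribed value. -/
theorem exists_isEquivariant_imageDim_le [Finite G] [Fintype σ] [Fintype τ]
    (R : Representation ℂ G (σ → ℂ)) (hR : Function.Injective R)
    (S : Representation ℂ G (τ → ℂ)) (w : τ → ℂ) :
    ∃ f : τ → MvPolynomial σ ℂ, IsEquivariant R S f ∧ (∃ v, ∀ j, eval v (f j) = w j) ∧
      imageDim f ≤ covdim G := by
  obtain ⟨n, m, φ, hφ, hd⟩ := covdim_mem G
  obtain ⟨u, hu⟩ := exists_trivial_stabilizer φ.target φ.poly hφ
  obtain ⟨v₀, hv₀⟩ := exists_trivial_stabilizer R (X : σ → MvPolynomial σ ℂ) (fun g hg => by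
    refine hR (LinearMap.ext fun v => ?_)
    simpa using hg v)
  simp only [eval_X] at hv₀
  -- The map sought is `θ ∘ φ ∘ ψ`, along `v₀ ↦ u ↦ φ u ↦ w`. Both `v₀` and `φ u` have trivial
  -- stabilizer, so interpolation is unobstructed.
  obtain ⟨ψ, hψ, hψv⟩ := exists_isEquivariant_eval_eq R φ.source v₀ u fun g hg => by
    simp [hv₀ g hg]
  obtain ⟨θ, hθ, hθv⟩ := exists_isEquivariant_eval_eq φ.target S (fun j => eval u (φ.poly j)) w
    fun g hg => by simp [hu g hg]
  have hev : ∀ v k, eval v (aeval ψ (aeval φ.poly (θ k))) =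
      eval (fun j => eval (fun i => eval v (ψ i)) (φ.poly j)) (θ k) := fun v k => by
    rw [eval_aeval_eq, eval_aeval_eq]
  refine ⟨fun k => aeval ψ (aeval φ.poly (θ k)), fun g v => ?_, ⟨v₀, fun k => ?_⟩, ?_⟩
  · simp only [hev]
    rw [hψ, φ.equivariant, hθ]
  · rw [hev]
    simp only [hψv]
    exact hθv k
  · have h1 : imageDim φ.poly = covdim G := by
      rw [φ.dim_eq_imageDim] at hd
      exact_mod_cast hd
    rw [← h1]
    refine le_trans (b := imageDim fun k => aeval φ.poly (θ k)) ?_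
      (imageDim_le_of_mem_adjoin fun k => ?_)
    · exact imageDim_le_of_forall_exists_eval_eq fun v => ⟨fun i => eval v (ψ i), fun j => by
        rw [eval_aeval_eq]⟩
    · rw [Algebra.adjoin_range_eq_range_aeval]
      exact ⟨_, rfl⟩

end

/-! ### Leading forms -/

section

section LeadingForm

variable {σ τ : Type} {M : Type*} [AddCommMonoid M] [LinearOrder M]

/-- `f₀` is homogeneous of degree `e`, and all monomials of `f - f₀` have degree below `e`. -/
def IsLeadingForm (w : σ → M) (e : M) (f f₀ : MvPolynomial σ ℂ) : Prop :=
  f₀.IsWeightedHomogeneous w e ∧ ∀ d ∈ (f - f₀).support, Finsupp.weight w d < e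

variable {w : σ → M}

theorem IsLeadingForm.weight_le {e : M} {f f₀ : MvPolynomial σ ℂ} (h : IsLeadingForm w e f f₀) :
    ∀ d ∈ f.support, Finsupp.weight w d ≤ e := by
  classical
  intro d hd
  rw [← sub_add_cancel f f₀] at hd
  rcases Finset.mem_union.1 (support_add hd) with hd | hd
  · exact (h.2 d hd).le
  · exact (h.1 (mem_support_iff.1 hd)).le

theorem isLeadingForm_weightedHomogeneousComponent {e : M} {f : MvPolynomial σ ℂ}
    (h : ∀ d ∈ f.support, Finsupp.weight w d ≤ e) :
    IsLeadingForm w e f (weightedHomogeneousComponent w e f) := by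
  classical
  refine ⟨weightedHomogeneousComponent_isWeightedHomogeneous e f, fun d hd => ?_⟩
  rw [mem_support_iff, coeff_sub, coeff_weightedHomogeneousComponent] at hd
  split_ifs at hd with hde
  · simp at hd
  · exact lt_of_le_of_ne (h d (mem_support_iff.2 (by simpa using hd))) hde

theorem isLeadingForm_one : IsLeadingForm w 0 (1 : MvPolynomial σ ℂ) 1 :=
  ⟨isWeightedHomogeneous_one ℂ w, by simp⟩

variable [IsOrderedCancelAddMonoid M]

theorem weight_lt_of_mem_support_mul {e e' : M} {p q : MvPolynomial σ ℂ}
    (hp : ∀ d ∈ p.support, Finsupp.weight w d < e)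
    (hq : ∀ d ∈ q.support, Finsupp.weight w d ≤ e') :
    ∀ d ∈ (p * q).support, Finsupp.weight w d < e + e' := by
  classical
  intro d hd
  obtain ⟨a, ha, b, hb, rfl⟩ := Finset.mem_add.1 (support_mul p q hd)
  rw [map_add]
  exact add_lt_add_of_lt_of_le (hp a ha) (hq b hb)

theorem IsLeadingForm.mul {e e' : M} {f f₀ g g₀ : MvPolynomial σ ℂ}
    (hf : IsLeadingForm w e f f₀) (hg : IsLeadingForm w e' g g₀) :
    IsLeadingForm w (e + e') (f * g) (f₀ * g₀) := by
  classical
  refine ⟨hf.1.mul hg.1, fun d hd => ?_⟩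
  have : f * g - f₀ * g₀ = (f - f₀) * g + (g - g₀) * f₀ := by ring
  rw [this] at hd
  rcases Finset.mem_union.1 (support_add hd) with hd | hd
  · exact weight_lt_of_mem_support_mul hf.2 hg.weight_le d hd
  · rw [add_comm]
    exact weight_lt_of_mem_support_mul hg.2 (fun d hd => (hf.1 (mem_support_iff.1 hd)).le) d hd

theorem IsLeadingForm.pow {e : M} {f f₀ : MvPolynomial σ ℂ} (hf : IsLeadingForm w e f f₀) (n : ℕ) :
    IsLeadingForm w (n • e) (f ^ n) (f₀ ^ n) := by
  induction n with
  | zero => simpa using isLeadingForm_one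
  | succ n ih => rw [pow_succ, pow_succ, succ_nsmul]; exact ih.mul hf

theorem IsLeadingForm.prod {ι : Type*} (s : Finset ι) {e : ι → M} {f f₀ : ι → MvPolynomial σ ℂ}
    (hf : ∀ i, IsLeadingForm w (e i) (f i) (f₀ i)) :
    IsLeadingForm w (∑ i ∈ s, e i) (∏ i ∈ s, f i) (∏ i ∈ s, f₀ i) := by
  classical
  induction s using Finset.induction_on with
  | empty => simpa using isLeadingForm_one
  | insert i s hi ih =>
    rw [Finset.prod_insert hi, Finset.prod_insert hi, Finset.sum_insert hi]
    exact (hf i).mul ih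

theorem IsLeadingForm.aeval_monomial {e : τ → M} {f f₀ : τ → MvPolynomial σ ℂ}
    (hf : ∀ i, IsLeadingForm w (e i) (f i) (f₀ i)) (d : τ →₀ ℕ) (c : ℂ) :
    IsLeadingForm w (Finsupp.weight e d) (aeval f (monomial d c)) (aeval f₀ (monomial d c)) := by
  rw [MvPolynomial.aeval_monomial, MvPolynomial.aeval_monomial, ← zero_add (Finsupp.weight e d),
    Finsupp.weight_apply]
  refine IsLeadingForm.mul ⟨isWeightedHomogeneous_C w c, by simp⟩ ?_
  exact IsLeadingForm.prod d.support (e := fun i => d i • e i) (f := fun i => f i ^ d i)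
    (f₀ := fun i => f₀ i ^ d i) fun i => (hf i).pow (d i)

/-- Give the `i`-th variable weight `e i`. If `P` is a relation among the `f i` with top weight part
`P₀`, then `P₀(f₀)` is the part of `P(f) = 0` in that weight, so `P₀` is a nonzero relation among
the `f₀ i`. -/
theorem algebraicIndependent_of_isLeadingForm {e : τ → M} {f f₀ : τ → MvPolynomial σ ℂ}
    (hf : ∀ i, IsLeadingForm w (e i) (f i) (f₀ i)) (h : AlgebraicIndependent ℂ f₀) :
    AlgebraicIndependent ℂ f := by
  classical
  rw [algebraicIndependent_iff] at h ⊢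
  intro P hP
  by_contra hP0
  obtain ⟨m, hm, hmax⟩ := Finset.exists_max_image P.support (Finsupp.weight e)
    (support_nonempty.2 hP0)
  set N := Finsupp.weight e m with hN
  let s := P.support.filter fun d => Finsupp.weight e d = N
  let P₀ : MvPolynomial τ ℂ := ∑ d ∈ s, monomial d (coeff d P)
  have hhom : (aeval f₀ P₀).IsWeightedHomogeneous w N := by
    rw [map_sum]
    refine IsWeightedHomogeneous.sum _ _ _ fun d hd => ?_
    rw [← (Finset.mem_filter.1 hd).2]
    exact (IsLeadingForm.aeval_monomial hf d _).1
  have hdiff : aeval f P - aeval f₀ P₀ =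
      ∑ d ∈ s, (aeval f (monomial d (coeff d P)) - aeval f₀ (monomial d (coeff d P))) +
      ∑ d ∈ P.support.filter (fun d => ¬ Finsupp.weight e d = N),
        aeval f (monomial d (coeff d P)) := by
    conv_lhs => rw [P.as_sum]
    rw [map_sum, ← Finset.sum_filter_add_sum_filter_not P.support
      (fun d => Finsupp.weight e d = N), map_sum, Finset.sum_sub_distrib]
    ring
  have hlow : ∀ d ∈ (aeval f P - aeval f₀ P₀).support, Finsupp.weight w d < N := by
    intro d hd
    rw [hdiff] at hd
    rcases Finset.mem_union.1 (support_add hd) with hd | hd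
    · obtain ⟨i, hi, hd⟩ := Finset.mem_biUnion.1 (support_sum hd)
      rw [← (Finset.mem_filter.1 hi).2]
      exact (IsLeadingForm.aeval_monomial hf i _).2 d hd
    · obtain ⟨i, hi, hd⟩ := Finset.mem_biUnion.1 (support_sum hd)
      obtain ⟨hi1, hi2⟩ := Finset.mem_filter.1 hi
      exact ((IsLeadingForm.aeval_monomial hf i _).weight_le d hd).trans_lt
        (lt_of_le_of_ne (hmax i hi1) hi2)
  -- It is homogeneous of degree `N`, while `hlow` puts all its monomials below `N`.
  have hzero : aeval f₀ P₀ = 0 := by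
    by_contra hne
    obtain ⟨d, hd⟩ := support_nonempty.2 hne
    have := hlow d (by rw [hP, zero_sub, support_neg]; exact hd)
    exact this.ne (hhom (mem_support_iff.1 hd))
  have hc : coeff m P₀ = coeff m P := by
    simp only [P₀, coeff_sum, coeff_monomial]
    rw [Finset.sum_ite_eq' s m]
    simp [s, hN, Finset.mem_filter, hm]
  rw [h P₀ hzero, coeff_zero] at hc
  exact mem_support_iff.1 hm hc.symm

theorem imageDim_le_of_isLeadingForm [Finite τ] {e : τ → M} {f f₀ : τ → MvPolynomial σ ℂ}
    (hf : ∀ i, IsLeadingForm w (e i) (f i) (f₀ i)) : imageDim f₀ ≤ imageDim f := by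
  obtain ⟨s, hs, hcard⟩ := exists_algebraicIndependent_card_eq_imageDim f₀
  rw [← hcard]
  exact card_le_imageDim (fun i : s => (i : τ))
    (algebraicIndependent_of_isLeadingForm (fun i : s => hf i) hs)

end LeadingForm

/-! ### Homogeneous components and gradings -/

section Homogeneous

variable {σ τ : Type} {M : Type*} [AddCommMonoid M] {w : σ → M}

theorem weightedHomogeneousComponent_aeval {l : σ → MvPolynomial σ ℂ}
    (hl : ∀ i, (l i).IsWeightedHomogeneous w (w i)) (e : M) (p : MvPolynomial σ ℂ) :
    weightedHomogeneousComponent w e (aeval l p) =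
      aeval l (weightedHomogeneousComponent w e p) := by
  classical
  induction p using MvPolynomial.induction_on' with
  | add p q hp hq => simp only [map_add, hp, hq]
  | monomial d c =>
    have h1 : (aeval l (monomial d c)).IsWeightedHomogeneous w (Finsupp.weight w d) := by
      rw [aeval_monomial, ← zero_add (Finsupp.weight w d), Finsupp.weight_apply]
      refine IsWeightedHomogeneous.mul (isWeightedHomogeneous_C w c) ?_
      exact IsWeightedHomogeneous.prod d.support (fun i => l i ^ d i) (fun i => d i • w i)
        fun i _ => (hl i).pow (d i)
    rw [weightedHomogeneousComponent_of_mem h1,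
      weightedHomogeneousComponent_of_mem (isWeightedHomogeneous_monomial w d c rfl)]
    split_ifs <;> simp

theorem isWeightedHomogeneous_linearPoly [Fintype σ] [DecidableEq σ]
    {L : (σ → ℂ) →ₗ[ℂ] (σ → ℂ)} (hL : ∀ i k, w i ≠ w k → L (Pi.single k 1) i = 0) (i : σ) :
    (linearPoly L i).IsWeightedHomogeneous w (w i) := by
  refine IsWeightedHomogeneous.sum _ _ _ fun k _ => ?_
  by_cases h : w i = w k
  · rw [h]
    exact (isWeightedHomogeneous_X ℂ w k).C_mul _
  · rw [hL i k h, C_0, zero_mul]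
    exact isWeightedHomogeneous_zero ℂ w _

/-- Taking homogeneous components preserves equivariance. -/
theorem IsEquivariant.weightedHomogeneousComponent {G : Type*} [Group G] [Fintype σ]
    [DecidableEq σ] [Fintype τ] [DecidableEq τ] {R : Representation ℂ G (σ → ℂ)}
    {S : Representation ℂ G (τ → ℂ)} {f : τ → MvPolynomial σ ℂ} (hf : IsEquivariant R S f)
    {e : τ → M} (hR : ∀ g i k, w i ≠ w k → R g (Pi.single k 1) i = 0)
    (hS : ∀ g i k, e i ≠ e k → S g (Pi.single k 1) i = 0) :
    IsEquivariant R S fun j => MvPolynomial.weightedHomogeneousComponent w (e j) (f j) := by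
  intro g v
  -- Equivariance as an identity of polynomials, whose component of degree `e j` is taken; `S g`
  -- does not mix coordinates of different degrees.
  have h1 : ∀ j, aeval (linearPoly (R g)) (f j) = aeval f (linearPoly (S g) j) := fun j =>
    MvPolynomial.funext fun v => by
      simpa only [eval_aeval_eq, eval_linearPoly] using congrFun (hf g v) j
  funext j
  have h2 := congrArg (MvPolynomial.weightedHomogeneousComponent w (e j)) (h1 j)
  rw [weightedHomogeneousComponent_aeval (isWeightedHomogeneous_linearPoly (hR g))] at h2
  have h3 := congrArg (eval v) h2
  simp only [eval_aeval_eq, eval_linearPoly] at h3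
  rw [h3, ← eval_linearPoly (S g)]
  simp only [linearPoly, map_sum, map_mul, aeval_X, eval_C, eval_X, algHom_C, algebraMap_eq,
    weightedHomogeneousComponent_C_mul]
  refine Finset.sum_congr rfl fun k _ => ?_
  by_cases h : e j = e k
  · rw [h]
  · simp [hS g j k h]

/-- Used to collapse the bigrading to a `ℤ`-grading. -/
theorem isWeightedHomogeneous_map {N : Type*} [AddCommMonoid N] (g : M →+ N)
    {p : MvPolynomial σ ℂ} {n : M} (hp : p.IsWeightedHomogeneous w n) :
    p.IsWeightedHomogeneous (fun i => g (w i)) (g n) := by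
  intro d hd
  rw [← hp hd, Finsupp.weight_apply, Finsupp.weight_apply, map_finsuppSum]
  simp

theorem eval_mul_of_isWeightedHomogeneous (c : Multiplicative M →* ℂ) {p : MvPolynomial σ ℂ}
    {n : M} (hp : p.IsWeightedHomogeneous w n) (v : σ → ℂ) :
    eval (fun i => c (.ofAdd (w i)) * v i) p = c (.ofAdd n) * eval v p := by
  rw [eval_eq, eval_eq, Finset.mul_sum]
  refine Finset.sum_congr rfl fun d hd => ?_
  rw [← hp (mem_support_iff.1 hd), Finsupp.weight_apply, Finsupp.sum, ofAdd_sum, map_prod]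
  simp only [mul_pow, Finset.prod_mul_distrib, ofAdd_nsmul, map_pow]
  ring

theorem isWeightedHomogeneous_zero_of_mem_adjoin {s : Set (MvPolynomial σ ℂ)}
    (hs : ∀ p ∈ s, p.IsWeightedHomogeneous w 0) {p : MvPolynomial σ ℂ}
    (hp : p ∈ Algebra.adjoin ℂ s) : p.IsWeightedHomogeneous w 0 := by
  induction hp using Algebra.adjoin_induction with
  | mem p hp => exact hs p hp
  | algebraMap r => exact isWeightedHomogeneous_C w r
  | add p q _ _ hp hq => exact hp.add hq
  | mul p q _ _ hp hq => simpa using hp.mul hq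

/-- In a relation `∑ cₙ qⁿ = 0` with `cₙ` of degree `0`, the terms have distinct degrees `n • k`, so
each vanishes. -/
theorem transcendental_of_isWeightedHomogeneous {w : σ → ℤ} {s : Set (MvPolynomial σ ℂ)}
    (hs : ∀ p ∈ s, p.IsWeightedHomogeneous w 0) {q : MvPolynomial σ ℂ} (hq0 : q ≠ 0) {k : ℤ}
    (hk : k ≠ 0) (hq : q.IsWeightedHomogeneous w k) :
    Transcendental (Algebra.adjoin ℂ s) q := by
  classical
  rw [transcendental_iff]
  intro P hP
  have hterm : ∀ n, ((P.coeff n : Algebra.adjoin ℂ s) * q ^ n : MvPolynomial σ ℂ)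
      |>.IsWeightedHomogeneous w (n • k) := fun n => by
    simpa using (isWeightedHomogeneous_zero_of_mem_adjoin hs (P.coeff n).2).mul (hq.pow n)
  ext1 n
  rw [Polynomial.aeval_eq_sum_range] at hP
  have h1 := congrArg (MvPolynomial.weightedHomogeneousComponent w (n • k)) hP
  rw [map_sum, map_zero, Finset.sum_eq_single n] at h1
  · rw [Algebra.smul_def] at h1
    have h2 : ((P.coeff n : Algebra.adjoin ℂ s) * q ^ n : MvPolynomial σ ℂ) = 0 := by
      rw [← h1]
      exact ((hterm n).weightedHomogeneousComponent_same).symm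
    simpa [hq0] using h2
  · intro m _ hmn
    refine IsWeightedHomogeneous.weightedHomogeneousComponent_ne (n • k) (hterm m) ?_
    simpa [hk] using Ne.symm hmn
  · intro hn
    rw [Finset.mem_range, not_lt] at hn
    rw [Polynomial.coeff_eq_zero_of_natDegree_lt (by omega)]
    simp

theorem imageDim_add_one_le [Finite τ] {w : σ → ℤ} {f : Option τ → MvPolynomial σ ℂ}
    (hf : ∀ i, (f (some i)).IsWeightedHomogeneous w 0) {k : ℤ} (hk : k ≠ 0)
    (hq : (f none).IsWeightedHomogeneous w k) (hq0 : f none ≠ 0) :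
    imageDim (fun i => f (some i)) + 1 ≤ imageDim f := by
  obtain ⟨s, hs, hcard⟩ := exists_algebraicIndependent_card_eq_imageDim fun i => f (some i)
  have h1 := (hs.option_iff_transcendental (f none)).2
    (transcendental_of_isWeightedHomogeneous (by rintro _ ⟨i, rfl⟩; exact hf i) hq0 hk hq)
  have h2 : Nat.card (Option s) ≤ imageDim f := by
    refine card_le_imageDim (fun o : Option s => o.map (fun i => (i : τ))) ?_
    convert h1 using 1
    funext o
    cases o <;> rfl
  rwa [Finite.card_option, hcard] at h2

end Homogeneous

end

/-! ### Modules `W ⊕ ℂ_χ` and bihomogeneous covariants -/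

section

section Block

variable {G : Type*} [Group G] {ι κ : Type}

/-- The direct sum of a representation on `ℂ^ι` and a character, in coordinates. -/
noncomputable def blockRep (ρ : Representation ℂ G (ι → ℂ)) (χ : G →* ℂˣ) :
    Representation ℂ G (Option ι → ℂ) where
  toFun g :=
    { toFun := fun v o => o.elim ((χ g : ℂ) * v none) fun i => ρ g (fun j => v (some j)) i
      map_add' := fun v w => by
        funext o
        cases o with
        | none => simp [mul_add]
        | some i => exact congrFun (map_add (ρ g) (fun j => v (some j)) fun j => w (some j)) i
      map_smul' := fun c v => by
        funext o
        cases o with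
        | none => simp [mul_left_comm]
        | some i => exact congrFun (map_smul (ρ g) c fun j => v (some j)) i }
  map_one' := by
    refine LinearMap.ext fun v => funext fun o => ?_
    cases o <;> simp
  map_mul' g h := by
    refine LinearMap.ext fun v => funext fun o => ?_
    cases o <;> simp [mul_assoc]

variable (ρ : Representation ℂ G (ι → ℂ)) (χ : G →* ℂˣ)

@[simp]
theorem blockRep_none (g : G) (v : Option ι → ℂ) : blockRep ρ χ g v none = χ g * v none := rfl

@[simp]
theorem blockRep_some (g : G) (v : Option ι → ℂ) (i : ι) :
    blockRep ρ χ g v (some i) = ρ g (fun j => v (some j)) i := rfl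

theorem blockRep_injective (h : ∀ g, ρ g = 1 → χ g = 1 → g = 1) :
    Function.Injective (blockRep ρ χ) := by
  rw [injective_iff_map_eq_one]
  intro g hg
  refine h g (LinearMap.ext fun v => funext fun i => ?_) (Units.ext ?_)
  · simpa using congrFun (LinearMap.congr_fun hg fun o => o.elim 0 v) (some i)
  · simpa using congrFun (LinearMap.congr_fun hg fun _ => 1) none

theorem blockRep_single_eq_zero [DecidableEq ι] {M : Type*} {e : Option ι → M}
    (he : ∀ i j, e (some i) = e (some j)) (g : G) (i k : Option ι) (h : e i ≠ e k) :
    blockRep ρ χ g (Pi.single k 1) i = 0 := by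
  cases i with
  | none =>
    cases k with
    | none => exact absurd rfl h
    | some k => simp
  | some i =>
    cases k with
    | none =>
      rw [blockRep_some]
      have : (fun j => (Pi.single none 1 : Option ι → ℂ) (some j)) = 0 := by
        funext j; simp
      rw [this, map_zero]
      rfl
    | some k => exact absurd (he i k) h

/-- Adding a character to a covariant raises the dimension by at most one. -/
theorem imageDim_option_le [Finite κ] (f : κ → MvPolynomial ι ℂ) (q : MvPolynomial (Option ι) ℂ) :
    imageDim (fun o : Option κ => o.elim q fun j => rename some (f j)) ≤ imageDim f + 1 := by
  obtain ⟨s, hs, hcard⟩ := exists_algebraicIndependent_card_eq_imageDim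
    (fun o : Option κ => o.elim q fun j => rename some (f j))
  rw [← hcard]
  let t : Set κ := some ⁻¹' s
  have h1 : AlgebraicIndependent ℂ fun j : t => f j := by
    have h2 := hs.comp (fun j : t => (⟨some j, j.2⟩ : s)) fun a b h => by
      simpa [Subtype.ext_iff] using h
    exact (AlgHom.algebraicIndependent_iff (rename (R := ℂ) (some : ι → Option ι))
      (rename_injective _ (Option.some_injective _))).1 h2
  have h2 := card_le_imageDim (fun j : t => (j : κ)) h1
  refine le_trans ?_ (Nat.add_le_add_right h2 1)
  rw [← Finite.card_option]
  refine Nat.card_le_card_of_injective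
    (fun o : s => (match o with | ⟨none, _⟩ => none | ⟨some j, h⟩ => some ⟨j, h⟩ : Option t)) ?_
  rintro ⟨_ | a, ha⟩ ⟨_ | b, hb⟩ h <;> simp_all

/-- Pull a minimal covariant of `Q` back along `π` and add the identity of `ℂ_χ`. -/
theorem covdim_le_add_one {Q : Type*} [Group Q] [Finite Q] (π : G →* Q) (χ : G →* ℂˣ)
    (h : ∀ g, π g = 1 → χ g = 1 → g = 1) : covdim G ≤ covdim Q + 1 := by
  obtain ⟨n, m, φ, hφ, hd⟩ := covdim_mem Q
  have hd' : imageDim φ.poly = covdim Q := by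
    rw [φ.dim_eq_imageDim] at hd
    exact_mod_cast hd
  rw [← hd']
  refine le_trans ?_ (imageDim_option_le φ.poly (X none))
  have hev : ∀ v : Option (Fin n) → ℂ, (fun j => eval v (rename some (φ.poly j))) =
      φ.toFun fun i => v (some i) := fun v => by
    funext j
    rw [eval_rename]
    rfl
  refine covdim_le_imageDim (blockRep (φ.source.comp π) χ) (blockRep (φ.target.comp π) χ) _
    (fun g v => ?_) fun g hg => ?_
  · funext o
    cases o with
    | none => simp
    | some j =>
      have h1 := congrFun (hev (blockRep (φ.source.comp π) χ g v)) j
      have h2 := congrFun (φ.equivariant (π g) fun i => v (some i)) j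
      simp only [Option.elim_some, blockRep_some, hev]
      exact h1.trans h2
  · refine h g (hφ _ fun v => funext fun j => ?_) (Units.ext ?_)
    · have h1 := congrFun (hg fun o => o.elim 0 v) (some j)
      simp only [Option.elim_some, blockRep_some, hev] at h1
      refine Eq.trans h1 ?_
      exact congrFun (hev fun o => o.elim 0 v) j
    · have h1 := congrFun (hg fun _ => 1) none
      simpa using h1

/-- The bidegree weights: `(1, 0)` for the coordinates of `ℂ^ι` and `(0, 1)` for the last one. -/
def bidegree (o : Option ι) : ℕ ×ₗ ℕ := o.elim (toLex (0, 1)) fun _ => toLex (1, 0)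

/-- The character `(a, b) ↦ s ^ a * r ^ b` of the monoid of bidegrees. -/
def torusHom (s r : ℂ) : Multiplicative (ℕ ×ₗ ℕ) →* ℂ where
  toFun m := s ^ (ofLex m.toAdd).1 * r ^ (ofLex m.toAdd).2
  map_one' := by simp
  map_mul' a b := by
    simp [pow_add]
    ring

theorem eval_scale {s r : ℂ} {p : MvPolynomial (Option ι) ℂ} {a b : ℕ}
    (hp : p.IsWeightedHomogeneous bidegree (toLex (a, b))) (v : Option ι → ℂ) :
    eval (fun o : Option ι => o.elim (r * v none) fun i => s * v (some i)) p =
      s ^ a * r ^ b * eval v p := by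
  have h := eval_mul_of_isWeightedHomogeneous (torusHom s r) hp v
  have h2 : (fun o : Option ι => torusHom s r (.ofAdd (bidegree o)) * v o) =
      fun o : Option ι => o.elim (r * v none) fun i => s * v (some i) := by
    funext o
    cases o <;> simp [torusHom, bidegree]
  rw [h2] at h
  rw [h]
  simp [torusHom]

theorem exists_bihomogeneous [Finite G] [Fintype ι] [Nonempty ι]
    (h : ∀ g, ρ g = 1 → χ g = 1 → g = 1) :
    ∃ (f : Option ι → MvPolynomial (Option ι) ℂ) (a b c d : ℕ),
      IsEquivariant (blockRep ρ χ) (blockRep ρ χ) f ∧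
      (∀ i, (f (some i)).IsWeightedHomogeneous bidegree (toLex (a, b))) ∧
      (f none).IsWeightedHomogeneous bidegree (toLex (c, d)) ∧
      (∃ i, f (some i) ≠ 0) ∧ f none ≠ 0 ∧ imageDim f ≤ covdim G := by
  classical
  -- The prescribed value with all coordinates `1` makes every component nonzero.
  obtain ⟨f, hf, ⟨v, hv⟩, hdim⟩ := exists_isEquivariant_imageDim_le (blockRep ρ χ)
    (blockRep_injective ρ χ h) (blockRep ρ χ) (fun _ => 1)
  have hne : ∀ o, (f o).support.Nonempty := fun o => support_nonempty.2 fun h0 => by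
    simpa [h0] using hv o
  obtain ⟨d₂, hd₂, hmax₂⟩ := Finset.exists_max_image (f none).support
    (Finsupp.weight (bidegree (ι := ι))) (hne none)
  -- `G` mixes the coordinates of `W`, so they must share one top bidegree for the leading forms to
  -- stay equivariant; only one of these is then certain to be nonzero.
  obtain ⟨d₁, hd₁, hmax₁⟩ := Finset.exists_max_image
    (Finset.univ.biUnion fun i => (f (some i)).support) (Finsupp.weight (bidegree (ι := ι))) (by
      obtain ⟨i⟩ := ‹Nonempty ι›
      obtain ⟨d, hd⟩ := hne (some i)
      exact ⟨d, Finset.mem_biUnion.2 ⟨i, Finset.mem_univ _, hd⟩⟩)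
  obtain ⟨i, -, hi⟩ := Finset.mem_biUnion.1 hd₁
  set m₁ := Finsupp.weight (bidegree (ι := ι)) d₁ with hm₁
  set m₂ := Finsupp.weight (bidegree (ι := ι)) d₂ with hm₂
  let e : Option ι → ℕ ×ₗ ℕ := fun o => o.elim m₂ fun _ => m₁
  let f₀ := fun o => weightedHomogeneousComponent (bidegree (ι := ι)) (e o) (f o)
  have hlead : ∀ o, IsLeadingForm bidegree (e o) (f o) (f₀ o) := fun o =>
    isLeadingForm_weightedHomogeneousComponent fun d hd => by
      cases o with
      | none => exact hmax₂ d hd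
      | some i => exact hmax₁ d (Finset.mem_biUnion.2 ⟨i, Finset.mem_univ _, hd⟩)
  refine ⟨f₀, (ofLex m₁).1, (ofLex m₁).2, (ofLex m₂).1, (ofLex m₂).2, ?_, fun i => (hlead (some i)).1,
    (hlead none).1, ⟨i, fun h0 => ?_⟩, fun h0 => ?_,
    (imageDim_le_of_isLeadingForm hlead).trans hdim⟩
  · exact hf.weightedHomogeneousComponent
      (blockRep_single_eq_zero ρ χ fun _ _ => rfl) (blockRep_single_eq_zero ρ χ fun _ _ => rfl)
  · have := congrArg (coeff d₁) h0
    simp only [f₀, e, Option.elim_some, coeff_weightedHomogeneousComponent, ← hm₁, if_true,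
      coeff_zero] at this
    exact mem_support_iff.1 hi this
  · have := congrArg (coeff d₂) h0
    simp only [f₀, e, Option.elim_none, coeff_weightedHomogeneousComponent, ← hm₂, if_true,
      coeff_zero] at this
    exact mem_support_iff.1 hd₂ this

variable {ρ χ}

/-- Here `g` acts on the source as a torus element, so it multiplies `f o` by a monomial in `s` and
`χ g`; compare with its action on the target where `f o` is nonzero. -/
theorem bidegree_congruence {f : Option ι → MvPolynomial (Option ι) ℂ}
    (hf : IsEquivariant (blockRep ρ χ) (blockRep ρ χ) f) {a b : ℕ} {o : Option ι}
    (ho : (f o).IsWeightedHomogeneous bidegree (toLex (a, b))) (h0 : f o ≠ 0) {g : G} {s : ℂ}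
    (hg : ρ g = s • 1) : s ^ a * (χ g : ℂ) ^ b = o.elim (χ g : ℂ) fun _ => s := by
  have hscale : ∀ v, blockRep ρ χ g v =
      fun o : Option ι => o.elim ((χ g : ℂ) * v none) fun i => s * v (some i) := fun v => by
    funext o
    cases o <;> simp [hg]
  obtain ⟨v, hv⟩ : ∃ v, eval v (f o) ≠ 0 := by
    by_contra! h
    exact h0 (MvPolynomial.funext fun v => by rw [h v, map_zero])
  have h1 := congrFun (hf g v) o
  simp only [hscale] at h1
  rw [eval_scale ho] at h1
  refine mul_right_cancel₀ hv (h1.trans ?_)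
  cases o <;> rfl

end Block

end

/-! ### The lower bound -/

section

variable {G : Type*} [Group G] {ι : Type}

theorem exists_rep_of_surjective {Q V : Type*} [Group Q] [AddCommGroup V] [Module ℂ V]
    (ρ : Representation ℂ G V) (π : G →* Q) (hπ : Function.Surjective π)
    (hker : ∀ g, π g = 1 → ρ g = 1) : ∃ ρ' : Representation ℂ Q V, ∀ g, ρ' (π g) = ρ g := by
  have key : ∀ g h, π g = π h → ρ g = ρ h := fun g h hgh => by
    have := hker (g * h⁻¹) (by rw [map_mul, map_inv, hgh, mul_inv_cancel])
    rw [← inv_mul_cancel_right g h, map_mul, this, one_mul]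
  have hs := Function.surjInv_eq hπ
  refine ⟨⟨⟨fun q => ρ (Function.surjInv hπ q), ?_⟩, ?_⟩, fun g => key _ _ (hs _)⟩
  · rw [key _ 1 (by rw [hs, map_one]), map_one]
  · intro a b
    rw [← map_mul]
    exact key _ _ (by rw [map_mul, hs, hs, hs])

/-- With the last coordinate set to `1`, `g` moves it to `χ g`; bihomogeneity restores it at the
cost of `χ g ^ b`. -/
theorem eval_option_rep {ρ : Representation ℂ G (ι → ℂ)} {χ : G →* ℂˣ}
    {f : Option ι → MvPolynomial (Option ι) ℂ}
    (hf : IsEquivariant (blockRep ρ χ) (blockRep ρ χ) f) {a b : ℕ}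
    (hW : ∀ i, (f (some i)).IsWeightedHomogeneous bidegree (toLex (a, b))) (g : G) (x : ι → ℂ) :
    (χ g : ℂ) ^ b • (fun i => eval (fun o : Option ι => o.elim 1 (ρ g x)) (f (some i))) =
      ρ g fun i => eval (fun o : Option ι => o.elim 1 x) (f (some i)) := by
  have h1 := hf g fun o => o.elim (1 : ℂ) x
  have h2 : blockRep ρ χ g (fun o => o.elim (1 : ℂ) x) = fun o : Option ι =>
      o.elim ((χ g : ℂ) * (fun o : Option ι => o.elim 1 (ρ g x)) none)
        fun i => 1 * (fun o : Option ι => o.elim 1 (ρ g x)) (some i) := by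
    funext o
    cases o <;> simp
  funext i
  have h3 := congrFun h1 (some i)
  rw [h2] at h3
  have h4 := eval_scale (s := 1) (r := χ g) (hW i) fun o => o.elim 1 (ρ g x)
  rw [one_pow, one_mul] at h4
  exact h4.symm.trans h3

/-- The `W`-component of a bihomogeneous covariant of `W ⊕ ℂ_χ` yields a faithful covariant of the
image of `G` in `GL(W)`. -/
theorem covdim_le_imageDim_some [Finite G] [Fintype ι] {Q : Type*} [Group Q] [Finite Q]
    {ρ : Representation ℂ G (ι → ℂ)} {χ : G →* ℂˣ}
    (hirr : ∀ U : Submodule ℂ (ι → ℂ), (∀ g, ∀ x ∈ U, ρ g x ∈ U) → U = ⊥ ∨ U = ⊤)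
    (π : G →* Q) (hπ : Function.Surjective π) (hker : ∀ g, π g = 1 ↔ ρ g = 1)
    {f : Option ι → MvPolynomial (Option ι) ℂ}
    (hf : IsEquivariant (blockRep ρ χ) (blockRep ρ χ) f) {a b : ℕ} (ha : a ≠ 0)
    (hW : ∀ i, (f (some i)).IsWeightedHomogeneous bidegree (toLex (a, b)))
    (h0 : ∃ i, f (some i) ≠ 0) : covdim Q ≤ imageDim fun i => f (some i) := by
  obtain ⟨ρ', hρ'⟩ := exists_rep_of_surjective ρ π hπ fun g => (hker g).1
  have hinj : ∀ q, ρ' q = 1 → q = 1 := fun q hq => by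
    obtain ⟨g, rfl⟩ := hπ q
    rw [hρ'] at hq
    exact (hker g).2 hq
  let ext (x : ι → ℂ) : Option ι → ℂ := fun o => o.elim 1 x
  obtain ⟨i₀, hi₀⟩ := h0
  -- the dehomogenized map is nonzero
  obtain ⟨x₀, hx₀⟩ : ∃ x, eval (ext x) (f (some i₀)) ≠ 0 := by
    obtain ⟨v, hv⟩ := exists_eval_ne_zero (fun _ : Unit => f (some i₀) * X none)
      fun _ => mul_ne_zero hi₀ (X_ne_zero none)
    have hv := hv ()
    rw [map_mul, eval_X] at hv
    refine ⟨fun i => v (some i), fun h => left_ne_zero_of_mul hv ?_⟩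
    have h1 := eval_scale (s := 1) (r := v none) (hW i₀) (ext fun i => v (some i))
    rw [h, mul_zero] at h1
    rw [← h1]
    congr 2
    funext o
    cases o <;> simp [ext]
  have hχ : ∀ g, ρ g = 1 → (χ g : ℂ) ^ b = 1 := fun g hg => by
    have h1 := congrFun (eval_option_rep hf hW g x₀) i₀
    simp only [hg, Module.End.one_apply, Pi.smul_apply, smul_eq_mul] at h1
    exact mul_right_cancel₀ hx₀ (by simpa [ext] using h1)
  -- a semi-invariant of weight `χ ^ b`
  obtain ⟨v₀, hv₀⟩ := exists_trivial_stabilizer ρ' (X : ι → MvPolynomial ι ℂ) fun q hq =>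
    hinj q (LinearMap.ext fun v => by simpa using hq v)
  simp only [eval_X] at hv₀
  let S : Representation ℂ G (Unit → ℂ) :=
    { toFun := fun g => (χ g : ℂ) ^ b • 1
      map_one' := by simp
      map_mul' := fun g h => by
        ext
        simp [mul_pow, mul_comm] }
  -- The stabilizer of `v₀` in `G` is the kernel of `ρ`, on which `χ ^ b` is trivial by `hχ`.
  obtain ⟨s, hs, hs1⟩ := exists_isEquivariant_eval_eq ρ S v₀ (fun _ => 1) fun g hg => by
    have h1 := hv₀ (π g) (by rw [hρ']; exact hg)
    simp [S, hχ g ((hker g).1 h1)]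
  have hs' : ∀ g x, eval (ρ g x) (s ()) = (χ g : ℂ) ^ b * eval x (s ()) := fun g x =>
    congrFun (hs g x) ()
  have hs0 : s () ≠ 0 := fun h => by simpa [h] using hs1 ()
  -- `F (g x) = χ(g)⁻ᵇ g F(x)`, and the factor `s` cancels this twist.
  let F : ι → MvPolynomial ι ℂ := fun i =>
    aeval (fun o : Option ι => o.elim 1 X) (f (some i))
  have hFev : ∀ x i, eval x (F i) = eval (ext x) (f (some i)) := fun x i => by
    simp only [F, eval_aeval_eq]
    congr 2
    funext o
    cases o <;> simp [ext]
  have hF0 : F i₀ ≠ 0 := fun h => hx₀ (by rw [← hFev, h, map_zero])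
  have hev : ∀ x, (fun i => eval x (s () * F i)) =
      eval x (s ()) • fun i => eval (ext x) (f (some i)) := fun x => by
    funext i
    simp [hFev]
  refine (covdim_le_imageDim ρ' ρ' (fun i => s () * F i) (fun q x => ?_) fun q hq => ?_).trans
    (imageDim_le_of_forall_exists_eval_eq fun x => ?_)
  · obtain ⟨g, rfl⟩ := hπ q
    rw [hρ', hev, hev, map_smul, ← eval_option_rep hf hW, smul_smul, hs', mul_comm]
  · obtain ⟨g, rfl⟩ := hπ q
    -- The span of the image is stable and nonzero, hence all of `W`; whatever fixes the image acts
    -- trivially on `W`.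
    let U : Submodule ℂ (ι → ℂ) := Submodule.span ℂ (Set.range fun x i => eval x (s () * F i))
    have hU : U = ⊤ := by
      refine (hirr U fun k x hx => ?_).resolve_left fun hbot => ?_
      · induction hx using Submodule.span_induction with
        | mem x hx =>
          obtain ⟨y, rfl⟩ := hx
          refine Submodule.subset_span ⟨ρ k y, ?_⟩
          simp only [hev]
          rw [map_smul, ← eval_option_rep hf hW, smul_smul, hs', mul_comm]
        | zero => rw [map_zero]; exact U.zero_mem
        | add x y _ _ hx hy => rw [map_add]; exact U.add_mem hx hy
        | smul c x _ hx => rw [map_smul]; exact U.smul_mem c hx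
      · refine mul_ne_zero hs0 hF0 (MvPolynomial.funext fun x => ?_)
        have hx : (fun i => eval x (s () * F i)) ∈ U := Submodule.subset_span ⟨x, rfl⟩
        rw [hbot, Submodule.mem_bot] at hx
        rw [map_zero]
        exact congrFun hx i₀
    refine (hker g).2 (LinearMap.ext fun y => ?_)
    have hy : y ∈ U := hU ▸ Submodule.mem_top
    induction hy using Submodule.span_induction with
    | mem x hx =>
      obtain ⟨y, rfl⟩ := hx
      rw [← hρ']
      exact hq y
    | zero => simp
    | add x y _ _ hx hy => rw [map_add, map_add, hx, hy]
    | smul c x _ hx => rw [map_smul, map_smul, hx]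
  · obtain ⟨c, hc⟩ := IsAlgClosed.exists_pow_nat_eq (eval x (s ())) (Nat.pos_of_ne_zero ha)
    refine ⟨fun o : Option ι => o.elim (1 * ext x none) fun i => c * ext x (some i), fun i => ?_⟩
    rw [eval_scale (hW i), one_pow, mul_one, hc]
    exact congrFun (hev x) i

theorem covdim_add_one_le [Finite G] [Fintype ι] [Nonempty ι] {Q : Type*} [Group Q] [Finite Q]
    {ρ : Representation ℂ G (ι → ℂ)} {χ : G →* ℂˣ}
    (hirr : ∀ U : Submodule ℂ (ι → ℂ), (∀ g, ∀ x ∈ U, ρ g x ∈ U) → U = ⊥ ∨ U = ⊤)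
    (hfaith : ∀ g, ρ g = 1 → χ g = 1 → g = 1)
    (π : G →* Q) (hπ : Function.Surjective π) (hker : ∀ g, π g = 1 ↔ ρ g = 1)
    {p : ℕ} (hp : p.Prime) {z h : G} {ζ : ℂ} (hζ : IsPrimitiveRoot ζ p) (hz : ρ z = ζ • 1)
    (hzχ : χ z = 1) (hh : ρ h = 1) (hhχ : IsPrimitiveRoot (χ h : ℂ) p) :
    covdim Q + 1 ≤ covdim G := by
  obtain ⟨f, a, b, c, d, hf, hW, hq, ⟨i, hi⟩, hq0, hdim⟩ := exists_bihomogeneous ρ χ hfaith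
  have e1 := bidegree_congruence hf (hW i) hi hz
  have e2 := bidegree_congruence hf hq hq0 hz
  have e3 := bidegree_congruence hf (hW i) hi (s := 1) (by rw [hh, one_smul])
  have e4 := bidegree_congruence hf hq hq0 (s := 1) (by rw [hh, one_smul])
  simp only [hzχ, Units.val_one, one_pow, mul_one, one_mul, Option.elim_some,
    Option.elim_none] at e1 e2 e3 e4
  have hsub : ∀ {x : ℂ} {n : ℕ}, IsPrimitiveRoot x p → x ^ n = x → (p : ℤ) ∣ n - 1 := by
    intro x n hx hn
    rw [← hx.zpow_eq_one_iff_dvd, zpow_sub₀ (hx.ne_zero hp.ne_zero), zpow_natCast, hn, zpow_one,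
      div_self (hx.ne_zero hp.ne_zero)]
  obtain ⟨a', ha'⟩ := hsub hζ e1
  obtain ⟨d', hd'⟩ := hsub hhχ e4
  obtain ⟨c', hc'⟩ := hζ.dvd_of_pow_eq_one c e2
  obtain ⟨b', hb'⟩ := hhχ.dvd_of_pow_eq_one b e3
  have hp1 : ¬ (p : ℤ) ∣ 1 := fun h1 =>
    hp.one_lt.ne' (Nat.dvd_one.1 (Int.natCast_dvd_natCast.1 (by rwa [Nat.cast_one])))
  have ha : a ≠ 0 := fun ha => hp1 ⟨-a', by rw [ha] at ha'; push_cast at ha'; linarith⟩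
  -- Modulo `p` one has `a, d ≡ 1` and `b, c ≡ 0`, so this is `-1`.
  have hdet : (b : ℤ) * c - a * d ≠ 0 := fun h0 => hp1 ⟨b' * (p * c') - a' - d' - a' * (p * d'), by
    have ha2 : (a : ℤ) = 1 + p * a' := by linarith
    have hd2 : (d : ℤ) = 1 + p * d' := by linarith
    rw [ha2, hd2, hb', hc'] at h0
    push_cast at h0
    linarith⟩
  -- Chosen to vanish on `(a, b)`; its value on `(c, d)` is the determinant above up to sign.
  let deg : ℕ ×ₗ ℕ →+ ℤ :=
    { toFun := fun m => b * (ofLex m).1 - a * (ofLex m).2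
      map_zero' := by simp
      map_add' := fun x y => by
        simp only [ofLex_add, Prod.fst_add, Prod.snd_add, Nat.cast_add]
        ring }
  have h1 := imageDim_add_one_le (w := fun o => deg (bidegree o)) (f := f) (fun i => by
      have := isWeightedHomogeneous_map deg (hW i)
      convert this using 1
      simp [deg, mul_comm]) hdet (by
      have := isWeightedHomogeneous_map deg hq
      exact this) hq0
  exact (Nat.add_le_add_right (covdim_le_imageDim_some hirr π hπ hker hf ha hW ⟨i, hi⟩) 1).trans
    (h1.trans hdim)

end

/-! ### Scalar actions, Schur's lemma and the two assertions -/

section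

section Scalars

variable {G V : Type*} [Group G] [AddCommGroup V] [Module ℂ V] {ρ : Representation ℂ G V} {p : ℕ}

theorem ActsAsScalars.exists_smul {P : Subgroup G} (h : ActsAsScalars ρ P p) {ζ : ℂ}
    (hζ : ζ ^ p = 1) : ∃ z ∈ P, ρ z = ζ • 1 := by
  have h1 : ζ • (1 : Module.End ℂ V) ∈ (fun g => ρ g) '' (P : Set G) := h ▸ ⟨ζ, hζ, rfl⟩
  exact h1

theorem actsAsScalars_zpowers [NeZero p] {z : G} {ζ : ℂ} (hζ : IsPrimitiveRoot ζ p)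
    (hz : ρ z = ζ • 1) : ActsAsScalars ρ (Subgroup.zpowers z) p := by
  have hpow : ∀ k : ℕ, ρ (z ^ k) = ζ ^ k • 1 := fun k => by
    rw [map_pow, hz, smul_pow, one_pow]
  apply Set.Subset.antisymm
  · rintro _ ⟨g, hg, rfl⟩
    obtain ⟨k, rfl⟩ := hg
    have hinv : ρ z⁻¹ = ζ⁻¹ • 1 := by
      have h1 : ρ z⁻¹ * ρ z = 1 := by rw [← map_mul, inv_mul_cancel, map_one]
      rw [hz, mul_smul_comm, mul_one] at h1
      rw [← h1, smul_smul, inv_mul_cancel₀ (hζ.ne_zero (NeZero.ne p)), one_smul]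
    rcases k with k | k
    · refine ⟨ζ ^ k, ?_, ?_⟩
      · rw [← pow_mul, mul_comm, pow_mul, hζ.pow_eq_one, one_pow]
      · simpa using hpow k
    · refine ⟨ζ⁻¹ ^ (k + 1), ?_, ?_⟩
      · rw [← pow_mul, mul_comm, pow_mul, inv_pow, hζ.pow_eq_one, inv_one, one_pow]
      · simp only [zpow_negSucc]
        rw [← inv_pow, map_pow, hinv, smul_pow, one_pow]
  · rintro _ ⟨ξ, hξ, rfl⟩
    obtain ⟨k, -, rfl⟩ := hζ.eq_pow_of_pow_eq_one hξ
    exact ⟨z ^ k, Subgroup.npow_mem_zpowers z k, hpow k⟩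

theorem prod_characterRep_eq_smul_iff [Nontrivial V] {χ : G →* ℂˣ} {g : G} {c : ℂ} :
    ρ.prod (characterRep χ) g = c • 1 ↔ ρ g = c • 1 ∧ (χ g : ℂ) = c := by
  have hchar : ∀ x : ℂ, characterRep χ g x = χ g * x := fun x => rfl
  constructor
  · intro h
    refine ⟨LinearMap.ext fun v => ?_, ?_⟩
    · exact congrArg Prod.fst (LinearMap.congr_fun h (v, 0))
    · have := congrArg Prod.snd (LinearMap.congr_fun h (0, 1))
      simpa [Representation.prod, hchar] using this
  · rintro ⟨h1, h2⟩
    refine LinearMap.ext fun x => Prod.ext ?_ ?_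
    · exact LinearMap.congr_fun h1 x.1
    · simp [Representation.prod, hchar, h2]

theorem eq_one_of_prod_injective {χ : G →* ℂˣ}
    (h : Function.Injective (ρ.prod (characterRep χ))) (g : G) (h1 : ρ g = 1) (h2 : χ g = 1) :
    g = 1 := by
  refine h (LinearMap.ext fun x => ?_)
  simp [Representation.prod, h1, characterRep, h2]

/-- Cauchy's theorem gives `h` of order `p`, and faithfulness forces `χ h ≠ 1`. -/
theorem exists_isPrimitiveRoot_of_dvd_card_ker [Finite G] {χ : G →* ℂˣ}
    (hfaith : ∀ g, ρ g = 1 → χ g = 1 → g = 1) (hp : p.Prime) (K : Subgroup G)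
    (hK : ∀ g ∈ K, ρ g = 1) (hdvd : p ∣ Nat.card K) :
    ∃ h, ρ h = 1 ∧ IsPrimitiveRoot (χ h : ℂ) p := by
  have := Fact.mk hp
  obtain ⟨⟨h, hh⟩, hord⟩ := exists_prime_orderOf_dvd_card' p hdvd
  rw [Subgroup.orderOf_mk] at hord
  refine ⟨h, hK h hh, ?_⟩
  have h1 : (χ h : ℂ) ^ p = 1 := by
    rw [← Units.val_pow_eq_pow_val, ← map_pow, ← hord, pow_orderOf_eq_one, map_one, Units.val_one]
  have h2 : (χ h : ℂ) ≠ 1 := fun h2 => by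
    rw [hfaith h (hK h hh) (Units.ext h2), orderOf_one] at hord
    exact hp.one_lt.ne hord
  exact IsPrimitiveRoot.iff_orderOf.2 (orderOf_eq_prime h1 h2)

/-- Multiplication by `h` or `h⁻¹` leaves the action on `W` alone and moves the value of `χ` between
`1` and `χ h`. -/
theorem exists_scalar_iff [Finite G] [Nontrivial V] {χ : G →* ℂˣ} (hp : p.Prime) {h : G}
    (hh : ρ h = 1) (hχ : IsPrimitiveRoot (χ h : ℂ) p) :
    (∃ P : Subgroup G, P ≤ χ.ker ∧ ActsAsScalars ρ P p) ↔
      ∃ P : Subgroup G, ActsAsScalars (ρ.prod (characterRep χ)) P p := by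
  have : NeZero p := ⟨hp.ne_zero⟩
  constructor
  · rintro ⟨P, hP, hact⟩
    obtain ⟨z, hzP, hz⟩ := hact.exists_smul hχ.pow_eq_one
    refine ⟨_, actsAsScalars_zpowers (z := z * h) hχ (prod_characterRep_eq_smul_iff.2 ⟨?_, ?_⟩)⟩
    · rw [map_mul, hz, hh, mul_one]
    · rw [map_mul, (hP hzP : χ z = 1), one_mul]
  · rintro ⟨P, hact⟩
    obtain ⟨z, hzP, hz⟩ := hact.exists_smul hχ.pow_eq_one
    obtain ⟨hz1, hz2⟩ := prod_characterRep_eq_smul_iff.1 hz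
    refine ⟨Subgroup.zpowers (z * h⁻¹), ?_, actsAsScalars_zpowers hχ ?_⟩
    · rw [Subgroup.zpowers_le, MonoidHom.mem_ker, map_mul, map_inv, Units.ext hz2, mul_inv_cancel]
    · have hinv : ρ h⁻¹ = 1 := by
        have := map_mul ρ h h⁻¹
        rwa [mul_inv_cancel, map_one, hh, one_mul, eq_comm] at this
      rw [map_mul, hz1, hinv, mul_one]

theorem isIrreducible_eq_bot_or_eq_top (hρ : ρ.IsIrreducible) (U : Submodule ℂ V)
    (hU : ∀ g, ∀ x ∈ U, ρ g x ∈ U) : U = ⊥ ∨ U = ⊤ := by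
  rcases hρ.eq_bot_or_eq_top ⟨U, fun g _ hx => hU g _ hx⟩ with h | h
  · exact Or.inl (congrArg Subrepresentation.toSubmodule h)
  · exact Or.inr (congrArg Subrepresentation.toSubmodule h)

theorem IsIrreducible.nontrivial_space (hρ : ρ.IsIrreducible) : Nontrivial V := by
  by_contra h
  rw [not_nontrivial_iff_subsingleton] at h
  obtain ⟨a, b, hab⟩ := hρ.toNontrivial
  exact hab (Subrepresentation.ext (Subsingleton.elim _ _))

/-- An element commuting with an irreducible representation acts as a scalar. -/
theorem exists_eq_smul_one_of_commute [FiniteDimensional ℂ V] [Nontrivial V]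
    (hirr : ∀ U : Submodule ℂ V, (∀ g, ∀ x ∈ U, ρ g x ∈ U) → U = ⊥ ∨ U = ⊤)
    (T : Module.End ℂ V) (hT : ∀ g, Commute T (ρ g)) : ∃ c : ℂ, T = c • 1 := by
  obtain ⟨c, hc⟩ := Module.End.exists_eigenvalue T
  refine ⟨c, LinearMap.ext fun x => ?_⟩
  have htop : Module.End.eigenspace T c = ⊤ := by
    refine (hirr _ fun g x hx => ?_).resolve_left hc
    rw [Module.End.mem_eigenspace_iff] at hx ⊢
    rw [← Module.End.mul_apply, (hT g).eq, Module.End.mul_apply, hx, map_smul]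
  have hx : x ∈ Module.End.eigenspace T c := htop ▸ Submodule.mem_top
  simpa using Module.End.mem_eigenspace_iff.1 hx

end Scalars

theorem covdim_eq_add_one {G Q W : Type*} [Group G] [Group Q] [Finite G] [Finite Q]
    [AddCommGroup W] [Module ℂ W] [FiniteDimensional ℂ W] [Nontrivial W]
    {ρ : Representation ℂ G W} {χ : G →* ℂˣ}
    (hirr : ∀ U : Submodule ℂ W, (∀ g, ∀ x ∈ U, ρ g x ∈ U) → U = ⊥ ∨ U = ⊤)
    (hfaith : ∀ g, ρ g = 1 → χ g = 1 → g = 1)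
    (π : G →* Q) (hπ : Function.Surjective π) (hker : ∀ g, π g = 1 ↔ ρ g = 1)
    {p : ℕ} (hp : p.Prime) {z h : G} {ζ : ℂ} (hζ : IsPrimitiveRoot ζ p) (hz : ρ z = ζ • 1)
    (hzχ : χ z = 1) (hh : ρ h = 1) (hhχ : IsPrimitiveRoot (χ h : ℂ) p) :
    covdim G = covdim Q + 1 := by
  refine le_antisymm (covdim_le_add_one π χ fun g hg => hfaith g ((hker g).1 hg)) ?_
  let e := (Module.finBasis ℂ W).equivFun
  have : Nonempty (Fin (Module.finrank ℂ W)) := ⟨⟨0, Module.finrank_pos⟩⟩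
  have hone : ∀ g (c : ℂ), conjRep e ρ g = c • 1 ↔ ρ g = c • 1 := fun g c => by
    constructor
    · intro h1
      refine LinearMap.ext fun w => e.injective ?_
      simpa using LinearMap.congr_fun h1 (e w)
    · intro h1
      refine LinearMap.ext fun w => ?_
      simp [h1]
  have hone' : ∀ g, conjRep e ρ g = 1 ↔ ρ g = 1 := fun g => by simpa using hone g 1
  refine covdim_add_one_le (ρ := conjRep e ρ) (fun U hU => ?_)
    (fun g hg => hfaith g ((hone' g).1 hg)) π hπ (fun g => (hker g).trans (hone' g).symm) hp hζ
    ((hone z ζ).2 hz) hzχ ((hone' h).2 hh) hhχ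
  rcases hirr (U.comap e.toLinearMap) fun g x hx => by simpa using hU g (e x) hx with h1 | h1
  · left
    rw [eq_bot_iff] at h1 ⊢
    intro x hx
    have := h1 (show e.symm x ∈ U.comap e.toLinearMap by simpa using hx)
    simpa using this
  · right
    rw [eq_top_iff] at h1 ⊢
    intro x _
    simpa using h1 (Submodule.mem_top (x := e.symm x))

theorem covdim_add_one_le_of_diagram {K G G' : Type*} [Group K] [Group G] [Group G'] [Finite G]
    [Finite G'] {p l m : ℕ} {i : K →* G} {χ : G →* rootsOfUnity (p ^ l) ℂ} {i' : K →* G'}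
    {χ' : G' →* rootsOfUnity (p ^ m) ℂ} {f : G →* G'} (hp : p.Prime) (hml : m < l)
    (hi : i.range = χ.ker) (hχ : Function.Surjective χ) (hi'inj : Function.Injective i')
    (hi' : i'.range = χ'.ker) (hfi : ∀ k, f (i k) = i' k)
    (hfχ : ∀ g, ((χ' (f g) : rootsOfUnity (p ^ m) ℂ) : ℂˣ) =
      ((χ g : rootsOfUnity (p ^ l) ℂ) : ℂˣ) ^ p ^ (l - m))
    (hG' : IsFaithfulGroup G') (hdvd : p ∣ Nat.card ↥(Subgroup.center G' ⊓ i'.range)) :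
    covdim G' + 1 ≤ covdim G := by
  have := Fact.mk hp
  obtain ⟨n, ρ, hρ, hinj⟩ := hG'
  have hnt := IsIrreducible.nontrivial_space hρ
  let ψ : G →* ℂˣ := (rootsOfUnity (p ^ l) ℂ).subtype.comp χ
  have hψ : ∀ g, ψ g = 1 ↔ χ g = 1 := fun g => by simp [ψ]
  have hlm : p ^ m * p ^ (l - m) = p ^ l := by rw [← pow_add]; congr 1; omega
  have hsurj : Function.Surjective f := by
    intro g'
    -- A `p ^ (l - m)`-th root of `χ' g'` lies in `μ_{p^l}`; lift it to `G` and correct by an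
    -- element of `K`.
    obtain ⟨ξ, hξ⟩ := IsAlgClosed.exists_pow_nat_eq (((χ' g' : ℂˣ) : ℂ))
      (pow_pos hp.pos (l - m))
    have hξ0 : ξ ≠ 0 := by
      rintro rfl
      rw [zero_pow (pow_pos hp.pos _).ne'] at hξ
      exact (χ' g' : ℂˣ).ne_zero hξ.symm
    have hξ1 : (Units.mk0 ξ hξ0) ^ p ^ (l - m) = (χ' g' : ℂˣ) := Units.ext (by simpa using hξ)
    have hmem : Units.mk0 ξ hξ0 ∈ rootsOfUnity (p ^ l) ℂ := by
      rw [mem_rootsOfUnity, ← hlm, mul_comm, pow_mul, hξ1]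
      exact (mem_rootsOfUnity _ _).1 (χ' g').2
    obtain ⟨g, hg⟩ := hχ ⟨_, hmem⟩
    have h1 : χ' (f g) = χ' g' := Subtype.ext (by rw [hfχ, hg]; exact hξ1)
    have h2 : (f g)⁻¹ * g' ∈ i'.range := by
      rw [hi', MonoidHom.mem_ker, map_mul, map_inv, h1, inv_mul_cancel]
    obtain ⟨k, hk⟩ := h2
    exact ⟨g * i k, by rw [map_mul, hfi, hk, mul_inv_cancel_left]⟩
  have hfaith : ∀ g, f g = 1 → ψ g = 1 → g = 1 := fun g h1 h2 => by
    have h3 : g ∈ i.range := by rw [hi, MonoidHom.mem_ker, ← hψ, h2]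
    obtain ⟨k, rfl⟩ := h3
    rw [hfi] at h1
    rw [hi'inj (h1.trans (map_one i').symm), map_one]
  have hker : ∀ g, f g = 1 ↔ ρ.comp f g = 1 := fun g =>
    ⟨fun h => by rw [MonoidHom.comp_apply, h, map_one],
      fun h => hinj (by rw [map_one]; exact h)⟩
  -- an element of order `p` in the centre acts as a scalar
  obtain ⟨⟨z', hz'⟩, hord⟩ := exists_prime_orderOf_dvd_card' p hdvd
  rw [Subgroup.orderOf_mk] at hord
  obtain ⟨hz'c, k, rfl⟩ := Subgroup.mem_inf.1 hz'
  obtain ⟨ζ, hζ⟩ := exists_eq_smul_one_of_commute (isIrreducible_eq_bot_or_eq_top hρ) (ρ (i' k))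
    fun g => by
      have := (Subgroup.mem_center_iff.1 hz'c g).symm
      exact (show Commute (i' k) g from this).map ρ
  have hζp : ∀ j : ℕ, ρ (i' k ^ j) = ζ ^ j • 1 := fun j => by
    rw [map_pow, hζ, smul_pow, one_pow]
  have hζprim : IsPrimitiveRoot ζ p := by
    refine IsPrimitiveRoot.iff_orderOf.2 (orderOf_eq_prime ?_ fun h1 => ?_)
    · have h1 := hζp p
      rw [← hord, pow_orderOf_eq_one, hord, map_one] at h1
      obtain ⟨v, hv⟩ := exists_ne (0 : Fin n → ℂ)
      have h2 := LinearMap.congr_fun h1 v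
      simp only [Module.End.one_apply, LinearMap.smul_apply] at h2
      exact (smul_left_injective ℂ hv (by simpa using h2)).symm
    · have h2 : i' k = 1 := hinj (by rw [hζ, h1, one_smul, map_one])
      rw [h2, orderOf_one] at hord
      exact hp.one_lt.ne hord
  have hzψ : ψ (i k) = 1 := by
    rw [hψ, ← MonoidHom.mem_ker, ← hi]
    exact ⟨k, rfl⟩
  -- an element of the kernel of `f` on which the character is primitive of order `p`
  obtain ⟨ω, hω⟩ : ∃ ω : ℂ, IsPrimitiveRoot ω p :=
    ⟨_, Complex.isPrimitiveRoot_exp p hp.ne_zero⟩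
  have hω0 : ω ≠ 0 := hω.ne_zero hp.ne_zero
  have hωpow : ∀ j, 0 < j → (Units.mk0 ω hω0) ^ p ^ j = 1 := fun j hj => by
    refine Units.ext ?_
    obtain ⟨j, rfl⟩ := Nat.exists_eq_add_of_lt hj
    simp [pow_succ', pow_mul, hω.pow_eq_one]
  -- Since `m < l`, raising to the power `p ^ (l - m)` kills `ω`. So `f g` comes from `K`, and
  -- dividing `g` by that element lands in the kernel of `f` without changing `χ`.
  obtain ⟨g, hg⟩ := hχ ⟨Units.mk0 ω hω0, (mem_rootsOfUnity _ _).2 (hωpow l (by omega))⟩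
  have h1 : f g ∈ i'.range := by
    rw [hi', MonoidHom.mem_ker]
    exact Subtype.ext (by rw [hfχ, hg]; exact hωpow (l - m) (by omega))
  obtain ⟨k', hk'⟩ := h1
  have hh : f (g * (i k')⁻¹) = 1 := by rw [map_mul, map_inv, hfi, hk', mul_inv_cancel]
  have hk'ψ : ψ (i k') = 1 := by
    rw [hψ, ← MonoidHom.mem_ker, ← hi]
    exact ⟨k', rfl⟩
  have hψg : (ψ (g * (i k')⁻¹) : ℂ) = ω := by
    rw [map_mul, map_inv, hk'ψ, inv_one, mul_one]
    simp [ψ, hg]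
  refine (covdim_eq_add_one (ρ := ρ.comp f) (χ := ψ) (fun U hU => ?_)
    (fun g hg => hfaith g ((hker g).2 hg)) f hsurj hker hp hζprim (z := i k) ?_ hzψ
    ((hker _).1 hh) (by rwa [hψg])).ge
  · refine isIrreducible_eq_bot_or_eq_top hρ U fun g' x hx => ?_
    obtain ⟨g, rfl⟩ := hsurj g'
    exact hU g x hx
  · rw [MonoidHom.comp_apply, hfi, hζ]

end

end CovariantDimension

theorem corollary4p6 :
    (∀ (G : Type*) [Group G] [Finite G]
        (W : Type*) [AddCommGroup W] [Module ℂ W] [FiniteDimensional ℂ W]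
        (ρ : Representation ℂ G W) (χ : G →* ℂˣ) (p : ℕ),
      ρ.IsIrreducible →
      Function.Injective (ρ.prod (CovariantDimension.characterRep χ)) →
      p.Prime →
      p ∣ Nat.card ρ.ker →
      ((∃ P : Subgroup G, P ≤ χ.ker ∧ CovariantDimension.ActsAsScalars ρ P p) ↔
        (∃ P : Subgroup G, CovariantDimension.ActsAsScalars
          (ρ.prod (CovariantDimension.characterRep χ)) P p)) ∧
      ((∃ P : Subgroup G, P ≤ χ.ker ∧ CovariantDimension.ActsAsScalars ρ P p) →
        CovariantDimension.covdim G = CovariantDimension.covdim (G ⧸ ρ.ker) + 1)) ∧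
    (∀ (K : Type*) (G : Type*) (G' : Type*) [Group K] [Group G] [Group G']
        [Finite G] [Finite G'] (p l m : ℕ)
        (i : K →* G) (χ : G →* rootsOfUnity (p ^ l) ℂ)
        (i' : K →* G') (χ' : G' →* rootsOfUnity (p ^ m) ℂ) (f : G →* G'),
      p.Prime →
      m < l →
      -- the two rows are exact
      Function.Injective i → i.range = χ.ker → Function.Surjective χ →
      Function.Injective i' → i'.range = χ'.ker → Function.Surjective χ' →
      -- the two squares commute
      (∀ k : K, f (i k) = i' k) →
      (∀ g : G, ((χ' (f g) : rootsOfUnity (p ^ m) ℂ) : ℂˣ) =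
        ((χ g : rootsOfUnity (p ^ l) ℂ) : ℂˣ) ^ p ^ (l - m)) →
      CovariantDimension.IsFaithfulGroup G' →
      p ∣ Nat.card ↥(Subgroup.center G' ⊓ i'.range) →
      CovariantDimension.covdim G' + 1 ≤ CovariantDimension.covdim G) := by
  refine ⟨?_, ?_⟩
  · intro G _ _ W _ _ _ ρ χ p hρ hinj hp hdvd
    have := CovariantDimension.IsIrreducible.nontrivial_space hρ
    have hfaith := CovariantDimension.eq_one_of_prod_injective hinj
    obtain ⟨h, hh, hhχ⟩ := CovariantDimension.exists_isPrimitiveRoot_of_dvd_card_ker hfaith hp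
      ρ.ker (fun g hg => hg) hdvd
    refine ⟨CovariantDimension.exists_scalar_iff hp hh hhχ, ?_⟩
    rintro ⟨P, hP, hact⟩
    -- The root `χ h` itself serves as the scalar by which `z` acts on `W`.
    obtain ⟨z, hzP, hz⟩ := hact.exists_smul hhχ.pow_eq_one
    exact CovariantDimension.covdim_eq_add_one
      (CovariantDimension.isIrreducible_eq_bot_or_eq_top hρ) hfaith (QuotientGroup.mk' ρ.ker)
      (QuotientGroup.mk'_surjective _) (fun g => QuotientGroup.eq_one_iff g) hp hhχ hz (hP hzP)
      hh hhχ
  · intro K G G' _ _ _ _ _ p l m i χ i' χ' f hp hml _ hi hχ hi'inj hi' _ hfi hfχ hG' hdvd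
    exact CovariantDimension.covdim_add_one_le_of_diagram hp hml hi hχ hi'inj hi' hfi hfχ hG' hdvd
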